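/- Let $1\le p,q<\infty$ with $p/q\notin\mathbb N$, and let $L_p(L_q)=L_p([0,1];L_q[0,1])$ (Lebesgue measure). A lattice embedding is a linear isometry (into) that is a lattice homomorphism, and for elements $x_i$ of $L_p(L_q)$, $\langle x_i\rangle_i$ denotes the closed sublattice they generate. Let $B\mathcal K_{p,q}$ be the class of finite-dimensional $BL_pL_q$ lattices, that is, of the finite-dimensional Banach lattices that are lattice isometric to a band of $L_p(\Omega;L_q(\Omega'))$ for some measure spaces $\Omega,\Omega'$. Let $\mathcal K_{p,q}$ be the class of sublattices (up to lattice isometry) of members of $B\mathcal K_{p,q}$. Let $e_1,\dots,e_m$ be mutually disjoint positive elements of norm one in $L_p(L_q)$, and let $E=\langle e_1,\dots,e_m\rangle$. Then the following hold. (1) $E\in\mathcal K_{p,q}$ if and only if there are $L\in\mathbb N$, a set $I\subseteq\{1,\dots,L\}\times\{1,\dots,m\}$ and mutually disjoint positive norm-one elements $\varphi(k,j)$, $(k,j)\in I$, of $L_p(L_q)$ such that (a) for each $j$, $e_j\in\langle\varphi(k,j)\rangle_{k:(k,j)\in I}$, and the elements $\varphi(k,j)$, $k$ with $(k,j)\in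 I$, are isometrically equivalent to the unit vector basis of a finite-dimensional $\ell_p$, i.e. $\|\sum_k a_k\varphi(k,j)\|^p=\sum_k|a_k|^p$ for all real $a_k$; (b) $\langle\varphi(k,j)\rangle_{(k,j)\in I}\in B\mathcal K_{p,q}$. If $E\in\mathcal K_{p,q}$, the $\varphi(k,j)$ can moreover be chosen so that for each $k$ the $\varphi(k,j)$ with $(k,j)\in I$ form the $k$-th $\ell_q$ block of an $\ell_p$-sum, i.e. $\|\sum_{(k,j)\in I}a_{k,j}\varphi(k,j)\|^p=\sum_{k=1}^L\big(\sum_{j:(k,j)\in I}|a_{k,j}|^q\big)^{p/q}$ for all real $a_{k,j}$. (2) If $E\in\mathcal K_{p,q}$ and $f_1,f_2:E\to L_p(L_q)$ are lattice embeddings, then there are $E'\in B\mathcal K_{p,q}$, a lattice embedding $\iota:E\to E'$ and lattice embeddings $f_1',f_2':E'\to L_p(L_q)$ such that $f_i'\circ\iota=f_i$ for $i=1,2$. -/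

import Mathlib

open MeasureTheory
open scoped ENNReal

noncomputable section

/-- The concrete lattice `L_p(Ω; L_q(Ω'))` of (classes of) Bochner measurable functions
`f : Ω → L_q(Ω')` with `ω ↦ ‖f ω‖_q` in `L_p(Ω)`, with its norm and its almost everywhere order. -/
abbrev MixedLp {Ω Ω' : Type*} [MeasurableSpace Ω] [MeasurableSpace Ω'] (p q : ℝ≥0∞)
    [Fact (1 ≤ q)] (μ : Measure Ω) (ν : Measure Ω') :=
  Lp (Lp ℝ q ν) p μ

/-- `L_p(L_q) = L_p([0,1]; L_q[0,1])` with Lebesgue measure on both factors. -/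
abbrev LpLq (p q : ℝ≥0∞) [Fact (1 ≤ q)] :=
  MixedLp p q (volume : Measure unitInterval) (volume : Measure unitInterval)

/-- A linear isometry that is a lattice homomorphism: an (isometric) lattice embedding. -/
def IsLatticeEmbedding {E F : Type*} [NormedAddCommGroup E] [NormedSpace ℝ E] [Lattice E]
    [NormedAddCommGroup F] [NormedSpace ℝ F] [Lattice F] (f : E →ₗᵢ[ℝ] F) : Prop :=
  ∀ x y : E, f (x ⊔ y) = f x ⊔ f y ∧ f (x ⊓ y) = f x ⊓ f y

/-- A band of a normed lattice: a solid linear subspace that contains every supremum (taken in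
the whole lattice) of its subsets. -/
def IsBand {X : Type*} [NormedAddCommGroup X] [NormedSpace ℝ X] [Lattice X]
    (S : Submodule ℝ X) : Prop :=
  (∀ x y : X, y ∈ S → |x| ≤ |y| → x ∈ S) ∧
    ∀ (A : Set X) (x : X), A ⊆ (S : Set X) → IsLUB A x → x ∈ S

/-- The class of finite-dimensional `BL_pL_q` lattices: the finite-dimensional lattices that are
lattice isometric to a band of some `L_p(Ω; L_q(Ω'))`. -/
def IsBK (p q : ℝ≥0∞) [Fact (1 ≤ p)] [Fact (1 ≤ q)] (E : Type*) [NormedAddCommGroup E]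
    [NormedSpace ℝ E] [Lattice E] : Prop :=
  FiniteDimensional ℝ E ∧
    ∃ (Ω Ω' : Type) (_ : MeasurableSpace Ω) (_ : MeasurableSpace Ω') (μ : Measure Ω)
      (ν : Measure Ω') (f : E →ₗᵢ[ℝ] MixedLp p q μ ν),
      IsLatticeEmbedding f ∧ IsBand (LinearMap.range f.toLinearMap)

/-- The class of lattices that are (lattice isometric to) sublattices of finite-dimensional
`BL_pL_q` lattices. -/
def IsK (p q : ℝ≥0∞) [Fact (1 ≤ p)] [Fact (1 ≤ q)] (E : Type*) [NormedAddCommGroup E]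
    [NormedSpace ℝ E] [Lattice E] : Prop :=
  ∃ (F : Type) (_ : NormedAddCommGroup F) (_ : NormedSpace ℝ F) (_ : Lattice F),
    IsBK p q F ∧ ∃ f : E →ₗᵢ[ℝ] F, IsLatticeEmbedding f

/-- A closed linear sublattice of a normed lattice. -/
structure ClosedSublattice (X : Type*) [NormedAddCommGroup X] [NormedSpace ℝ X] [Lattice X]
    extends Submodule ℝ X where
  sup_mem' : ∀ ⦃x y : X⦄, x ∈ carrier → y ∈ carrier → x ⊔ y ∈ carrier
  inf_mem' : ∀ ⦃x y : X⦄, x ∈ carrier → y ∈ carrier → x ⊓ y ∈ carrier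
  isClosed' : IsClosed carrier

/-- A closed sublattice is a lattice under the operations of the ambient lattice. -/
instance ClosedSublattice.instLattice {X : Type*} [NormedAddCommGroup X] [NormedSpace ℝ X]
    [Lattice X] (S : ClosedSublattice X) : Lattice S.toSubmodule :=
  Subtype.lattice (P := fun x : X => x ∈ S.toSubmodule)
    (fun _ _ hx hy => S.sup_mem' hx hy) (fun _ _ hx hy => S.inf_mem' hx hy)

/-- The Banach lattice generated by a set: the smallest closed linear sublattice containing it. -/
def ClosedSublattice.generate {X : Type*} [NormedAddCommGroup X] [NormedSpace ℝ X]
    [Lattice X] (s : Set X) : ClosedSublattice X where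
  carrier := {x | ∀ S : ClosedSublattice X, s ⊆ (S.toSubmodule : Set X) → x ∈ S.toSubmodule}
  add_mem' := fun hx hy S hS => S.toSubmodule.add_mem (hx S hS) (hy S hS)
  zero_mem' := fun S _ => S.toSubmodule.zero_mem
  smul_mem' := fun c _ hx S hS => S.toSubmodule.smul_mem c (hx S hS)
  sup_mem' := fun _ _ hx hy S hS => S.sup_mem' (hx S hS) (hy S hS)
  inf_mem' := fun _ _ hx hy S hS => S.inf_mem' (hx S hS) (hy S hS)
  isClosed' := by
    simp only [Set.ofPred_forall]
    exact isClosed_iInter fun S => isClosed_iInter fun _ => S.isClosed'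

/-- A family of mutually disjoint positive elements of norm one. -/
def IsDisjointNormalizedPositive {X ι : Type*} [NormedAddCommGroup X] [Lattice X]
    (x : ι → X) : Prop :=
  (∀ i, 0 ≤ x i) ∧ (∀ i, ‖x i‖ = 1) ∧ ∀ i i', i ≠ i' → x i ⊓ x i' = 0

/-- The family `φ(k,j)`, indexed by a set `I` of pairs `(k,j)`, consists of mutually disjoint
normalized positive elements; each `e_j` lies in the lattice generated by the `φ(k,j)` in column
`j`, which are isometrically equivalent to the unit vector basis of a finite-dimensional `ℓ_p`;
and all the `φ(k,j)` together generate a finite-dimensional `BL_pL_q` lattice. -/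
def IsAtomRefinement (p q : ℝ≥0∞) [Fact (1 ≤ p)] [Fact (1 ≤ q)] {m L : ℕ}
    (e : Fin m → LpLq p q) (I : Finset (Fin L × Fin m)) (φ : I → LpLq p q) : Prop :=
  IsDisjointNormalizedPositive φ ∧
  (∀ j : Fin m, e j ∈ (ClosedSublattice.generate (φ '' {i : I | i.1.2 = j})).toSubmodule) ∧
  (∀ (j : Fin m) (a : I → ℝ),
    ‖∑ i : I with i.1.2 = j, a i • φ i‖ ^ p.toReal =
      ∑ i : I with i.1.2 = j, |a i| ^ p.toReal) ∧
  IsBK p q (ClosedSublattice.generate (Set.range φ)).toSubmodule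

/-- For each `k`, the elements `φ(k,j)` in row `k` form the unit vector basis of the `k`-th summand
of an `ℓ_p`-sum of finite-dimensional `ℓ_q` spaces. -/
def HasRowBlocks (p q : ℝ≥0∞) [Fact (1 ≤ p)] [Fact (1 ≤ q)] {m L : ℕ}
    (I : Finset (Fin L × Fin m)) (φ : I → LpLq p q) : Prop :=
  ∀ a : I → ℝ, ‖∑ i : I, a i • φ i‖ ^ p.toReal =
    ∑ k : Fin L, (∑ i : I with i.1.1 = k, |a i| ^ q.toReal) ^ (p.toReal / q.toReal)

end

/-!
Let `x` be a finite family of disjoint positive elements of `L_p(L_q)`. For `b ≥ 0` the norm of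
`∑ j, b j ^ (1/q) • x j`, to the power `p`, is the integral of `(∑ j, b j * y j) ^ (p/q)` against
the *profile measure* of `x`: the distribution on the simplex of the proportions
`y j = ‖x j ω‖ ^ q / ∑ i, ‖x i ω‖ ^ q`, with weight `(∑ i, ‖x i ω‖ ^ q) ^ (p/q)`. Since `p/q` is
not an integer, the Taylor coefficients of these integrals in `b` recover all the moments, so the
profile measure depends only on the norm of the span of `x`, and is the same for every isometric
lattice copy of it. If such a copy lies in a finite-dimensional band, restricting it to the level
sets of the proportions gives disjoint elements of the band, so the profile measure has finitely
many atoms. Restricting any copy to these level sets and normalizing splits it into the atoms of an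
`ℓ_p`-sum of `ℓ_q` spaces, with coefficients read off the profile measure alone; the atoms of two
copies therefore correspond isometrically.
-/

noncomputable section

section VectorLattice

variable {ι κ X Y : Type*}

section AddCommGroup

variable [AddCommGroup X] [Lattice X]

/-- Pairwise disjoint positive elements of a vector lattice. Unlike in
`IsDisjointNormalizedPositive`, the elements may vanish and no norm is involved. -/
def IsDisjointPositive (x : ι → X) : Prop :=
  (∀ i, 0 ≤ x i) ∧ ∀ i j, i ≠ j → x i ⊓ x j = 0

theorem IsDisjointPositive.comp_injective {x : ι → X} (hx : IsDisjointPositive x) {f : κ → ι}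
    (hf : f.Injective) : IsDisjointPositive (x ∘ f) :=
  ⟨fun i => hx.1 (f i), fun i j hij => hx.2 (f i) (f j) (hf.ne hij)⟩

variable [IsOrderedAddMonoid X]

theorem inf_add_eq_zero {u v w : X} (hu : 0 ≤ u) (hv : 0 ≤ v) (hw : 0 ≤ w) (huv : u ⊓ v = 0)
    (huw : u ⊓ w = 0) : u ⊓ (v + w) = 0 := by
  have h_sub : u ⊓ (v + w) - w ≤ u ⊓ v :=
    le_inf ((sub_le_self _ hw).trans inf_le_left) (sub_le_iff_le_add.2 inf_le_right)
  have h_le : u ⊓ (v + w) ≤ w := sub_nonpos.1 (h_sub.trans_eq huv)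
  exact le_antisymm ((le_inf inf_le_left h_le).trans_eq huw) (le_inf hu (add_nonneg hv hw))

theorem inf_sum_eq_zero {u : X} {v : ι → X} (s : Finset ι) (hu : 0 ≤ u) (hv : ∀ i ∈ s, 0 ≤ v i)
    (huv : ∀ i ∈ s, u ⊓ v i = 0) : u ⊓ ∑ i ∈ s, v i = 0 := by
  classical
  induction s using Finset.induction_on with
  | empty => simpa using hu
  | insert a s ha ih =>
    rw [Finset.forall_mem_insert] at hv huv
    rw [Finset.sum_insert ha]
    exact inf_add_eq_zero hu hv.1 (Finset.sum_nonneg hv.2) huv.1 (ih hv.2 huv.2)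

variable [Module ℝ X] [PosSMulMono ℝ X]

theorem inf_smul_eq_zero {u v : X} (hu : 0 ≤ u) (hv : 0 ≤ v) (huv : u ⊓ v = 0) {t : ℝ}
    (ht : 0 ≤ t) : u ⊓ t • v = 0 := by
  have h_nat (n : ℕ) : u ⊓ (n : ℝ) • v = 0 := by
    induction n with
    | zero => simpa using hu
    | succ n ih =>
      rw [Nat.cast_succ, add_smul, one_smul]
      exact inf_add_eq_zero hu (smul_nonneg n.cast_nonneg hv) hv ih huv
  obtain ⟨n, hn⟩ := exists_nat_ge t
  have h_le : t • v ≤ (n : ℝ) • v := by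
    rw [← sub_nonneg, ← sub_smul]
    exact smul_nonneg (sub_nonneg.2 hn) hv
  exact le_antisymm ((inf_le_inf_left _ h_le).trans_eq (h_nat n)) (le_inf hu (smul_nonneg ht hv))

namespace IsDisjointPositive

variable {φ : ι → X}

theorem smul (hφ : IsDisjointPositive φ) {t : ι → ℝ} (ht : ∀ i, 0 ≤ t i) :
    IsDisjointPositive fun i => t i • φ i := by
  refine ⟨fun i => smul_nonneg (ht i) (hφ.1 i), fun i j hij => ?_⟩
  refine inf_smul_eq_zero (smul_nonneg (ht i) (hφ.1 i)) (hφ.1 j) ?_ (ht j)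
  rw [inf_comm]
  exact inf_smul_eq_zero (hφ.1 j) (hφ.1 i) (hφ.2 j i hij.symm) (ht i)

theorem inf_sum_sum [Fintype ι] (hφ : IsDisjointPositive φ) {s t : ι → ℝ} (hs : ∀ i, 0 ≤ s i)
    (ht : ∀ i, 0 ≤ t i) (hst : ∀ i, s i = 0 ∨ t i = 0) :
    (∑ i, s i • φ i) ⊓ ∑ i, t i • φ i = 0 := by
  have hsφ (i : ι) : 0 ≤ s i • φ i := smul_nonneg (hs i) (hφ.1 i)
  have htφ (i : ι) : 0 ≤ t i • φ i := smul_nonneg (ht i) (hφ.1 i)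
  refine inf_sum_eq_zero _ (Finset.sum_nonneg fun i _ => hsφ i) (fun i _ => htφ i) fun j _ => ?_
  rw [inf_comm]
  refine inf_sum_eq_zero _ (htφ j) (fun i _ => hsφ i) fun i _ => ?_
  rcases eq_or_ne j i with rfl | hji
  · rcases hst j with h0 | h0
    · rw [h0, zero_smul, inf_eq_right.2 (htφ j)]
    · rw [h0, zero_smul, inf_eq_left.2 (hsφ j)]
  · refine inf_smul_eq_zero (htφ j) (hφ.1 i) ?_ (hs i)
    rw [inf_comm]
    exact inf_smul_eq_zero (hφ.1 i) (hφ.1 j) (hφ.2 i j hji.symm) (ht j)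

theorem sum_inf [Fintype ι] (hφ : IsDisjointPositive φ) (a b : ι → ℝ) :
    (∑ i, a i • φ i) ⊓ ∑ i, b i • φ i = ∑ i, (a i ⊓ b i) • φ i := by
  have h_disj : (∑ i, (a i - a i ⊓ b i) • φ i) ⊓ ∑ i, (b i - a i ⊓ b i) • φ i = 0 := by
    refine hφ.inf_sum_sum (fun i => sub_nonneg.2 inf_le_left) (fun i => sub_nonneg.2 inf_le_right)
      fun i => ?_
    rcases le_total (a i) (b i) with h | h
    · exact Or.inl (by rw [inf_eq_left.2 h, sub_self])
    · exact Or.inr (by rw [inf_eq_right.2 h, sub_self])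
  rw [← zero_add (∑ i, (a i ⊓ b i) • φ i), ← h_disj, inf_add]
  simp only [sub_smul, Finset.sum_sub_distrib, sub_add_cancel]

theorem sum_sup [Fintype ι] (hφ : IsDisjointPositive φ) (a b : ι → ℝ) :
    (∑ i, a i • φ i) ⊔ ∑ i, b i • φ i = ∑ i, (a i ⊔ b i) • φ i := by
  have h_neg := congrArg Neg.neg (hφ.sum_inf (-a) (-b))
  simpa only [Pi.neg_apply, neg_smul, Finset.sum_neg_distrib, neg_inf, neg_neg, ← neg_sup]
    using h_neg

theorem linearIndependent [Finite ι] (hφ : IsDisjointPositive φ) (hne : ∀ i, φ i ≠ 0) :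
    LinearIndependent ℝ φ := by
  have := Fintype.ofFinite ι
  rw [Fintype.linearIndependent_iff]
  intro a ha i
  have h_abs : ∑ i, |a i| • φ i = 0 := by
    have h_sup := hφ.sum_sup a (-a)
    simp only [Pi.neg_apply, neg_smul, Finset.sum_neg_distrib, ha, neg_zero, sup_idem] at h_sup
    exact h_sup.symm
  have h_zero := (Finset.sum_eq_zero_iff_of_nonneg
    fun i _ => smul_nonneg (abs_nonneg (a i)) (hφ.1 i)).1 h_abs i (Finset.mem_univ i)
  exact abs_eq_zero.1 ((smul_eq_zero.1 h_zero).resolve_right (hne i))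

theorem card_le_finrank [Fintype ι] (hφ : IsDisjointPositive φ) (hne : ∀ i, φ i ≠ 0)
    {S : Submodule ℝ X} [FiniteDimensional ℝ S] (hS : ∀ i, φ i ∈ S) :
    Fintype.card ι ≤ Module.finrank ℝ S := by
  have h_indep : LinearIndependent ℝ fun i => (⟨φ i, hS i⟩ : S) :=
    LinearIndependent.of_comp S.subtype (hφ.linearIndependent hne)
  exact h_indep.fintype_card_le_finrank

end IsDisjointPositive

section Basis

variable [Finite ι] {b : Module.Basis ι ℝ X}

theorem IsDisjointPositive.repr_inf (hb : IsDisjointPositive b) (x y : X) (i : ι) :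
    b.repr (x ⊓ y) i = b.repr x i ⊓ b.repr y i := by
  have := Fintype.ofFinite ι
  conv_lhs => rw [← b.sum_repr x, ← b.sum_repr y, hb.sum_inf, b.repr_sum_self]

theorem IsDisjointPositive.repr_sup (hb : IsDisjointPositive b) (x y : X) (i : ι) :
    b.repr (x ⊔ y) i = b.repr x i ⊔ b.repr y i := by
  have := Fintype.ofFinite ι
  conv_lhs => rw [← b.sum_repr x, ← b.sum_repr y, hb.sum_sup, b.repr_sum_self]

theorem IsDisjointPositive.le_iff_repr_le (hb : IsDisjointPositive b) {x y : X} :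
    x ≤ y ↔ ∀ i, b.repr x i ≤ b.repr y i := by
  rw [← inf_eq_left, b.ext_elem_iff]
  simp only [hb.repr_inf, inf_eq_left]

theorem IsDisjointPositive.repr_abs (hb : IsDisjointPositive b) (x : X) (i : ι) :
    b.repr |x| i = |b.repr x i| := by
  rw [abs, hb.repr_sup, map_neg, Finsupp.neg_apply, abs]

end Basis

end AddCommGroup

section Normed

variable [NormedAddCommGroup X] [NormedSpace ℝ X] [Lattice X]
  [NormedAddCommGroup Y] [NormedSpace ℝ Y] [Lattice Y]

theorem IsLatticeEmbedding.comp {Z : Type*} [NormedAddCommGroup Z] [NormedSpace ℝ Z] [Lattice Z]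
    {g : Y →ₗᵢ[ℝ] Z} {f : X →ₗᵢ[ℝ] Y} (hg : IsLatticeEmbedding g) (hf : IsLatticeEmbedding f) :
    IsLatticeEmbedding (g.comp f) := fun x y =>
  ⟨(congrArg g (hf x y).1).trans (hg _ _).1, (congrArg g (hf x y).2).trans (hg _ _).2⟩

theorem IsDisjointPositive.map {f : X →ₗᵢ[ℝ] Y} (hf : IsLatticeEmbedding f) {x : ι → X}
    (hx : IsDisjointPositive x) : IsDisjointPositive (f ∘ x) := by
  refine ⟨fun i => ?_, fun i j hij => ?_⟩
  · have h_sup := (hf (x i) 0).1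
    rw [sup_eq_left.2 (hx.1 i), map_zero] at h_sup
    exact sup_eq_left.1 h_sup.symm
  · rw [Function.comp_apply, Function.comp_apply, ← (hf (x i) (x j)).2, hx.2 i j hij, map_zero]

variable [IsOrderedAddMonoid X] [PosSMulMono ℝ X] {b : Module.Basis ι ℝ X}

theorem IsDisjointPositive.isBand_span_image [Finite ι] (hb : IsDisjointPositive b) (s : Set ι) :
    IsBand (Submodule.span ℝ (b '' s)) := by
  classical
  have h_mem {x : X} : x ∈ Submodule.span ℝ (b '' s) ↔ ∀ i ∉ s, b.repr x i = 0 := by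
    rw [b.mem_span_image, Set.subset_def]
    exact forall_congr' fun i => by
      rw [Finset.mem_coe, Finsupp.mem_support_iff, ← not_imp_not, not_not]
  refine ⟨fun x y hy hxy => h_mem.2 fun i hi => ?_, fun A x hA hx => h_mem.2 fun i hi => ?_⟩
  · have h_abs := hb.le_iff_repr_le.1 hxy i
    rw [hb.repr_abs, hb.repr_abs, h_mem.1 hy i hi, abs_zero] at h_abs
    exact abs_nonpos_iff.1 h_abs
  · rcases A.eq_empty_or_nonempty with rfl | ⟨a, ha⟩
    · have h_bot (y : X) : x ≤ y := hx.2 (by simp [upperBounds_empty])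
      have h_nonneg : 0 ≤ x := (le_add_iff_nonneg_left x).1 (h_bot (x + x))
      rw [le_antisymm (h_bot 0) h_nonneg, map_zero, Finsupp.zero_apply]
    · have h_repr {y : X} (hy : y ∈ A) : b.repr y i = 0 := h_mem.1 (hA hy) i hi
      have h_upper : x - b.repr x i • b i ∈ upperBounds A := fun y hy => hb.le_iff_repr_le.2
        fun j => by
          rw [map_sub, map_smul, b.repr_self, Finsupp.sub_apply, Finsupp.smul_single_one]
          rcases eq_or_ne i j with rfl | hij
          · rw [Finsupp.single_eq_same, sub_self, h_repr hy]
          · rw [Finsupp.single_eq_of_ne hij.symm, sub_zero]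
            exact hb.le_iff_repr_le.1 (hx.1 hy) j
      refine le_antisymm ?_ (h_repr ha ▸ hb.le_iff_repr_le.1 (hx.1 ha) i)
      have h_le := hb.le_iff_repr_le.1 (hx.2 h_upper) i
      rwa [map_sub, map_smul, b.repr_self, Finsupp.sub_apply, Finsupp.smul_single_one,
        Finsupp.single_eq_same, sub_self] at h_le

variable [Fintype ι] [IsOrderedAddMonoid Y] [PosSMulMono ℝ Y]

theorem IsDisjointPositive.exists_latticeEmbedding {ψ : ι → Y} (hb : IsDisjointPositive b)
    (hψ : IsDisjointPositive ψ) (hnorm : ∀ a : ι → ℝ, ‖∑ i, a i • ψ i‖ = ‖∑ i, a i • b i‖) :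
    ∃ g : X →ₗᵢ[ℝ] Y, IsLatticeEmbedding g ∧ ∀ i, g (b i) = ψ i := by
  have h_apply (x : X) : b.constr ℝ ψ x = ∑ i, b.repr x i • ψ i := by
    simp only [b.constr_apply_fintype ℝ, b.equivFun_apply]
  refine ⟨⟨b.constr ℝ ψ, fun x => ?_⟩, fun x y => ?_, fun i => b.constr_basis ℝ ψ i⟩
  · rw [h_apply, hnorm, b.sum_repr]
  · change b.constr ℝ ψ _ = b.constr ℝ ψ _ ⊔ b.constr ℝ ψ _ ∧
      b.constr ℝ ψ _ = b.constr ℝ ψ _ ⊓ b.constr ℝ ψ _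
    simp only [h_apply, hψ.sum_sup, hψ.sum_inf, hb.repr_sup, hb.repr_inf, and_self]

end Normed

end VectorLattice

section ClosedSublattice

variable {ι X Y : Type*} [NormedAddCommGroup X] [NormedSpace ℝ X] [Lattice X]

namespace ClosedSublattice

theorem subset_generate (s : Set X) : s ⊆ ((generate s).toSubmodule : Set X) :=
  fun _ hx _ hS => hS hx

theorem generate_le {s : Set X} {S : ClosedSublattice X} (h : s ⊆ (S.toSubmodule : Set X)) :
    (generate s).toSubmodule ≤ S.toSubmodule :=
  fun _ hx => hx S h

instance [IsOrderedAddMonoid X] (S : ClosedSublattice X) : IsOrderedAddMonoid S.toSubmodule where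
  add_le_add_left _ _ h c := add_le_add_left (α := X) h c

instance [PosSMulMono ℝ X] (S : ClosedSublattice X) : PosSMulMono ℝ S.toSubmodule where
  smul_le_smul_of_nonneg_left _ hc _ _ h := smul_le_smul_of_nonneg_left (β := X) h hc

theorem isLatticeEmbedding_subtypeₗᵢ (S : ClosedSublattice X) :
    IsLatticeEmbedding S.toSubmodule.subtypeₗᵢ :=
  fun _ _ => ⟨rfl, rfl⟩

theorem exists_latticeEmbedding_of_le {S T : ClosedSublattice X}
    (h : S.toSubmodule ≤ T.toSubmodule) :
    ∃ j : S.toSubmodule →ₗᵢ[ℝ] T.toSubmodule,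
      IsLatticeEmbedding j ∧ ∀ x, (j x : X) = x :=
  ⟨⟨Submodule.inclusion h, fun _ => rfl⟩, fun _ _ => ⟨rfl, rfl⟩, fun _ => rfl⟩

/-- The member `x i` of a family, as an element of the closed sublattice generated by the family. -/
def generator (x : ι → X) (i : ι) : (generate (Set.range x)).toSubmodule :=
  ⟨x i, subset_generate _ ⟨i, rfl⟩⟩

end ClosedSublattice

open ClosedSublattice

namespace IsDisjointPositive

theorem generator {x : ι → X} (hx : IsDisjointPositive x) :
    IsDisjointPositive (ClosedSublattice.generator x) :=
  ⟨hx.1, fun i j hij => Subtype.ext (hx.2 i j hij)⟩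

variable [IsOrderedAddMonoid X] [PosSMulMono ℝ X] {φ : ι → X}

section Finite

variable [Finite ι]

theorem generate_range_eq_span (hφ : IsDisjointPositive φ) :
    (generate (Set.range φ)).toSubmodule = Submodule.span ℝ (Set.range φ) := by
  have := Fintype.ofFinite ι
  refine le_antisymm ?_ (Submodule.span_le.2 (subset_generate _))
  let S : ClosedSublattice X :=
    { Submodule.span ℝ (Set.range φ) with
      sup_mem' := by
        intro x y hx hy
        obtain ⟨a, rfl⟩ := Submodule.mem_span_range_iff_exists_fun ℝ |>.1 hx
        obtain ⟨b, rfl⟩ := Submodule.mem_span_range_iff_exists_fun ℝ |>.1 hy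
        exact Submodule.mem_span_range_iff_exists_fun ℝ |>.2 ⟨_, (hφ.sum_sup a b).symm⟩
      inf_mem' := by
        intro x y hx hy
        obtain ⟨a, rfl⟩ := Submodule.mem_span_range_iff_exists_fun ℝ |>.1 hx
        obtain ⟨b, rfl⟩ := Submodule.mem_span_range_iff_exists_fun ℝ |>.1 hy
        exact Submodule.mem_span_range_iff_exists_fun ℝ |>.2 ⟨_, (hφ.sum_inf a b).symm⟩
      isClosed' :=
        have := FiniteDimensional.span_of_finite ℝ (Set.finite_range φ)
        Submodule.closed_of_finiteDimensional (Submodule.span ℝ (Set.range φ)) }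
  exact generate_le (S := S) Submodule.subset_span

theorem span_range_generator (hφ : IsDisjointPositive φ) :
    Submodule.span ℝ (Set.range (ClosedSublattice.generator φ)) = ⊤ := by
  apply Submodule.map_injective_of_injective (Submodule.subtype_injective _)
  rw [Submodule.map_span, Submodule.map_subtype_top, ← Set.range_comp]
  exact hφ.generate_range_eq_span.symm

theorem finiteDimensional_generate (hφ : IsDisjointPositive φ) :
    FiniteDimensional ℝ (generate (Set.range φ)).toSubmodule :=
  hφ.generate_range_eq_span ▸ FiniteDimensional.span_of_finite ℝ (Set.finite_range φ)

/-- The generators as a basis of the closed sublattice generated by nonzero disjoint positive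
elements. -/
def generateBasis (hφ : IsDisjointPositive φ) (hne : ∀ i, φ i ≠ 0) :
    Module.Basis ι ℝ (generate (Set.range φ)).toSubmodule :=
  Module.Basis.mk (v := ClosedSublattice.generator φ)
    (hφ.generator.linearIndependent fun i h => hne i (congrArg Subtype.val h))
    hφ.span_range_generator.ge

theorem coe_generateBasis (hφ : IsDisjointPositive φ) (hne : ∀ i, φ i ≠ 0) :
    ⇑(hφ.generateBasis hne) = ClosedSublattice.generator φ :=
  Module.Basis.coe_mk _ _

end Finite

theorem exists_latticeEmbedding_generate [Fintype ι] [NormedAddCommGroup Y] [NormedSpace ℝ Y]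
    [Lattice Y] [IsOrderedAddMonoid Y] [PosSMulMono ℝ Y] {ψ : ι → Y} (hφ : IsDisjointPositive φ)
    (hne : ∀ i, φ i ≠ 0) (hψ : IsDisjointPositive ψ)
    (hnorm : ∀ a : ι → ℝ, ‖∑ i, a i • ψ i‖ = ‖∑ i, a i • φ i‖) :
    ∃ g : (generate (Set.range φ)).toSubmodule →ₗᵢ[ℝ] Y,
      IsLatticeEmbedding g ∧ ∀ i, g (ClosedSublattice.generator φ i) = ψ i := by
  have h_basis := hφ.coe_generateBasis hne
  rw [← h_basis]
  refine IsDisjointPositive.exists_latticeEmbedding (h_basis ▸ hφ.generator) hψ fun a => ?_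
  rw [hnorm, h_basis, Submodule.coe_norm, Submodule.coe_sum]
  rfl

end IsDisjointPositive

end ClosedSublattice

theorem IsDisjointPositive.indicator_const {α ι κ E : Type*} [AddCommGroup E] [Lattice E]
    {v : ι → E} (hv : IsDisjointPositive v) {A : κ → Set α}
    (hdisj : Pairwise fun k l => Disjoint (A k) (A l)) (x : α) :
    IsDisjointPositive fun i : κ × ι => (A i.1).indicator (fun _ => v i.2) x := by
  have h_nonneg (i : κ × ι) : 0 ≤ (A i.1).indicator (fun _ => v i.2) x :=
    Set.indicator_apply_nonneg fun _ => hv.1 i.2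
  refine ⟨h_nonneg, fun i j hij => ?_⟩
  dsimp only
  by_cases hi : x ∈ A i.1
  · by_cases hj : x ∈ A j.1
    · have h_fst : i.1 = j.1 := by
        by_contra hne
        exact Set.disjoint_left.1 (hdisj hne) hi hj
      rw [Set.indicator_of_mem hi, Set.indicator_of_mem hj]
      exact hv.2 _ _ fun h_snd => hij (Prod.ext h_fst h_snd)
    · rw [Set.indicator_of_notMem hj]
      exact inf_eq_right.2 (h_nonneg i)
  · rw [Set.indicator_of_notMem hi]
    exact inf_eq_left.2 (h_nonneg j)

section LpFamilies

variable {α ι κ E : Type*} [MeasurableSpace α] {μ : Measure α} {p : ℝ≥0∞} [NormedAddCommGroup E]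

instance instPosSMulMonoLp [NormedSpace ℝ E] [PartialOrder E] [PosSMulMono ℝ E] :
    PosSMulMono ℝ (Lp E p μ) where
  smul_le_smul_of_nonneg_left c hc f g hfg := by
    rw [← Lp.coeFn_le] at hfg ⊢
    filter_upwards [Lp.coeFn_smul c f, Lp.coeFn_smul c g, hfg] with x h_smul_f h_smul_g h_le
    rw [h_smul_f, h_smul_g]
    exact smul_le_smul_of_nonneg_left h_le hc

theorem toReal_pos_of_one_le [hp1 : Fact (1 ≤ p)] (hp : p ≠ ∞) : 0 < p.toReal :=
  ENNReal.toReal_pos (zero_lt_one.trans_le hp1.out).ne' hp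

theorem toReal_div_toReal_ne_natCast {q : ℝ≥0∞} [hq1 : Fact (1 ≤ q)] (hp : p ≠ ∞)
    (hpq : ∀ n : ℕ, p / q ≠ (n : ℝ≥0∞)) (n : ℕ) :
    p.toReal / q.toReal ≠ n := by
  have hq0 : q ≠ 0 := (zero_lt_one.trans_le hq1.out).ne'
  rw [← ENNReal.toReal_div]
  intro h_eq
  refine hpq n ?_
  rw [← ENNReal.ofReal_toReal (ENNReal.div_ne_top hp hq0), h_eq, ENNReal.ofReal_natCast]

theorem norm_rpow_eq_integral_Lp [hp1 : Fact (1 ≤ p)] (hp : p ≠ ∞) (f : Lp E p μ) :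
    ‖f‖ ^ p.toReal = ∫ x, ‖f x‖ ^ p.toReal ∂μ := by
  have hp0 : p ≠ 0 := (zero_lt_one.trans_le hp1.out).ne'
  rw [Lp.norm_def, toReal_eLpNorm (Lp.aestronglyMeasurable f),
    lpNorm_eq_integral_norm_rpow_toReal hp0 hp (Lp.aestronglyMeasurable f),
    Real.rpow_inv_rpow (integral_nonneg fun x => by positivity) (toReal_pos_of_one_le hp).ne']

theorem coeFn_sum_smul_Lp [NormedSpace ℝ E] (s : Finset ι) (a : ι → ℝ) (f : ι → Lp E p μ) :
    ⇑(∑ i ∈ s, a i • f i) =ᵐ[μ] fun x => ∑ i ∈ s, a i • f i x := by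
  have h_smul : ∀ᵐ x ∂μ, ∀ i ∈ s, (a i • f i) x = a i • f i x :=
    (ae_ball_iff s.countable_toSet).2 fun i _ => Lp.coeFn_smul (a i) (f i)
  filter_upwards [Lp.coeFn_finsetSum s fun i => a i • f i, h_smul] with x h_sum h_smul
  rw [h_sum, Finset.sum_apply]
  exact Finset.sum_congr rfl h_smul

theorem isDisjointPositive_iff_ae [Countable ι] [Lattice E] [HasSolidNorm E]
    [IsOrderedAddMonoid E] {f : ι → Lp E p μ} :
    IsDisjointPositive f ↔ ∀ᵐ x ∂μ, IsDisjointPositive fun i => f i x := by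
  simp only [IsDisjointPositive, Filter.eventually_and, ae_all_iff]
  refine and_congr (forall_congr' fun i => (Lp.coeFn_nonneg (f i)).symm)
    (forall_congr' fun i => forall_congr' fun j => imp_congr_right fun _ => ?_)
  rw [Lp.eq_zero_iff_ae_eq_zero]
  refine Filter.eventually_congr ?_
  filter_upwards [Lp.coeFn_inf (f i) (f j)] with x h_inf
  rw [h_inf, Pi.inf_apply, Pi.zero_apply]

/-- The class of `1_A f`: the component of `f` in the band of functions supported on `A`. -/
def indicatorLp {A : Set α} (hA : MeasurableSet A) (f : Lp E p μ) : Lp E p μ :=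
  ((Lp.memLp f).indicator hA).toLp _

theorem coeFn_indicatorLp {A : Set α} (hA : MeasurableSet A) (f : Lp E p μ) :
    ⇑(indicatorLp hA f) =ᵐ[μ] A.indicator f :=
  MemLp.coeFn_toLp _

section Lattice

variable [Lattice E] [HasSolidNorm E] [IsOrderedAddMonoid E]

theorem abs_indicatorLp_le {A : Set α} (hA : MeasurableSet A) (f : Lp E p μ) :
    |indicatorLp hA f| ≤ |f| := by
  rw [← Lp.coeFn_le]
  filter_upwards [Lp.coeFn_abs (indicatorLp hA f), Lp.coeFn_abs f, coeFn_indicatorLp hA f]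
    with x h_abs_ind h_abs h_ind
  rw [h_abs_ind, h_abs, h_ind]
  by_cases hx : x ∈ A
  · rw [Set.indicator_of_mem hx]
  · rw [Set.indicator_of_notMem hx, abs_zero]
    exact abs_nonneg _

theorem IsDisjointPositive.indicator [Countable ι] [Countable κ] {f : ι → Lp E p μ}
    (hf : IsDisjointPositive f) {A : κ → Set α} (hA : ∀ k, MeasurableSet (A k))
    (hdisj : Pairwise fun k l => Disjoint (A k) (A l)) :
    IsDisjointPositive fun i : κ × ι => indicatorLp (hA i.1) (f i.2) := by
  rw [isDisjointPositive_iff_ae] at hf ⊢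
  filter_upwards [hf, ae_all_iff.2 fun i : κ × ι => coeFn_indicatorLp (hA i.1) (f i.2)]
    with x hfx h_ind
  simp only [h_ind]
  exact hfx.indicator_const hdisj x

end Lattice

end LpFamilies

section NormFormula

variable {ι Ω Ω' : Type*} [Fintype ι] [MeasurableSpace Ω] [MeasurableSpace Ω'] {p q : ℝ≥0∞}
  [Fact (1 ≤ q)] {μ : Measure Ω} {ν : Measure Ω'}

theorem IsDisjointPositive.abs_sum_rpow {x : ι → ℝ} (hx : IsDisjointPositive x) (a : ι → ℝ)
    {s : ℝ} (hs : s ≠ 0) : |∑ i, a i * x i| ^ s = ∑ i, |a i| ^ s * |x i| ^ s := by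
  by_cases h : ∃ i, x i ≠ 0
  · obtain ⟨i, hi⟩ := h
    have h_zero {j : ι} (hj : j ≠ i) : x j = 0 := by
      rcases min_choice (x j) (x i) with h_min | h_min
      · exact h_min.symm.trans (hx.2 j i hj)
      · exact absurd (h_min.symm.trans (hx.2 j i hj)) hi
    rw [Fintype.sum_eq_single i fun j hj => by rw [h_zero hj, mul_zero],
      Fintype.sum_eq_single i fun j hj => by
        rw [h_zero hj, abs_zero, Real.zero_rpow hs, mul_zero],
      abs_mul, Real.mul_rpow (abs_nonneg _) (abs_nonneg _)]
  · push Not at h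
    simp only [h, mul_zero, Finset.sum_const_zero, abs_zero, Real.zero_rpow hs]

theorem IsDisjointPositive.norm_sum_rpow (hq : q ≠ ∞) {f : ι → Lp ℝ q ν}
    (hf : IsDisjointPositive f) (a : ι → ℝ) :
    ‖∑ i, a i • f i‖ ^ q.toReal = ∑ i, |a i| ^ q.toReal * ‖f i‖ ^ q.toReal := by
  have hq0 : q ≠ 0 := (zero_lt_one.trans_le (Fact.out : 1 ≤ q)).ne'
  simp only [norm_rpow_eq_integral_Lp hq, ← integral_const_mul]
  rw [← integral_finsetSum _ fun i _ =>
    ((Lp.memLp (f i)).integrable_norm_rpow hq0 hq).const_mul _]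
  refine integral_congr_ae ?_
  filter_upwards [isDisjointPositive_iff_ae.1 hf, coeFn_sum_smul_Lp Finset.univ a f]
    with x hfx h_sum
  rw [h_sum]
  exact hfx.abs_sum_rpow a (toReal_pos_of_one_le hq).ne'

namespace MixedLp

theorem measurable_norm_rpow (f : MixedLp p q μ ν) : Measurable fun ω => ‖f ω‖ ^ q.toReal :=
  (Lp.stronglyMeasurable f).norm.measurable.pow_const _

variable {h : ι → MixedLp p q μ ν}

theorem ae_norm_sum_rpow (hq : q ≠ ∞) (hh : IsDisjointPositive h) (a : ι → ℝ) :
    ∀ᵐ ω ∂μ, ‖(∑ i, a i • h i) ω‖ ^ q.toReal =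
      ∑ i, |a i| ^ q.toReal * ‖h i ω‖ ^ q.toReal := by
  filter_upwards [isDisjointPositive_iff_ae.1 hh, coeFn_sum_smul_Lp Finset.univ a h]
    with ω hω h_sum
  rw [h_sum, hω.norm_sum_rpow hq]

theorem norm_sum_rpow [Fact (1 ≤ p)] (hp : p ≠ ∞) (hq : q ≠ ∞) (hh : IsDisjointPositive h)
    (a : ι → ℝ) :
    ‖∑ i, a i • h i‖ ^ p.toReal =
      ∫ ω, (∑ i, |a i| ^ q.toReal * ‖h i ω‖ ^ q.toReal) ^ (p.toReal / q.toReal) ∂μ := by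
  rw [norm_rpow_eq_integral_Lp hp]
  refine integral_congr_ae ?_
  filter_upwards [ae_norm_sum_rpow hq hh a] with ω hω
  rw [← hω, ← Real.rpow_mul (norm_nonneg _), mul_div_cancel₀ _ (toReal_pos_of_one_le hq).ne']

end MixedLp

end NormFormula

section Equimeasurability

open Filter Topology

theorem hasSum_choose_mul_pow (r : ℝ) {x : ℝ} (hx : |x| < 1) :
    HasSum (fun n => Ring.choose r n * x ^ n) ((1 + x) ^ r) := by
  have h := (Real.one_add_rpow_hasFPowerSeriesOnBall_zero (a := r)).hasSum (y := x)
    (by simpa [enorm_eq_nnnorm, ← NNReal.coe_lt_coe] using hx)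
  simpa only [binomialSeries_apply, List.ofFn_const, List.prod_replicate, smul_eq_mul, zero_add]
    using h

theorem summable_norm_choose_mul_pow (r : ℝ) {x : ℝ} (hx0 : 0 ≤ x) (hx1 : x < 1) :
    Summable fun n => ‖Ring.choose r n‖ * x ^ n := by
  lift x to NNReal using hx0
  have h_radius : (x : ℝ≥0∞) < (binomialSeries ℝ r).radius :=
    lt_of_lt_of_le (by exact_mod_cast hx1) binomialSeries_radius_ge_one
  simpa only [binomialSeries, FormalMultilinearSeries.ofScalars_norm]
    using (binomialSeries ℝ r).summable_norm_mul_pow h_radius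

theorem choose_ne_zero_of_ne_natCast {r : ℝ} (hr : ∀ n : ℕ, r ≠ n) (n : ℕ) :
    Ring.choose r n ≠ 0 := by
  have h_prod : ∏ j ∈ Finset.range n, (r - j) ≠ 0 :=
    Finset.prod_ne_zero_iff.2 fun j _ => sub_ne_zero.2 (hr j)
  rw [Ring.choose_eq_smul, ← Polynomial.aeval_eq_smeval, ← Polynomial.eval_map_algebraMap,
    descPochhammer_map, descPochhammer_eval_eq_prod_range]
  exact smul_ne_zero (inv_ne_zero (Nat.cast_ne_zero.2 n.factorial_ne_zero)) h_prod

theorem eq_of_eventually_hasSum_pow {a b : ℕ → ℝ} {f : ℝ → ℝ}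
    (ha : ∀ᶠ t in 𝓝 0, HasSum (fun n => a n * t ^ n) (f t))
    (hb : ∀ᶠ t in 𝓝 0, HasSum (fun n => b n * t ^ n) (f t)) : a = b := by
  have h_series {c : ℕ → ℝ} (hc : ∀ᶠ t in 𝓝 0, HasSum (fun n => c n * t ^ n) (f t)) :
      HasFPowerSeriesAt f (FormalMultilinearSeries.ofScalars ℝ c) 0 := by
    rw [hasFPowerSeriesAt_iff]
    simpa only [FormalMultilinearSeries.coeff_ofScalars, smul_eq_mul, zero_add, mul_comm] using hc
  exact FormalMultilinearSeries.ofScalars_series_injective ℝ ℝ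
    ((h_series ha).eq_formalMultilinearSeries (h_series hb))

variable {α 𝕜 : Type*} [MeasurableSpace α] {σ τ : Measure α} [IsFiniteMeasure σ]
  [IsFiniteMeasure τ]

theorem hasSum_mul_integral_pow [RCLike 𝕜] {y : α → 𝕜} (hy : Measurable y) {C : ℝ}
    (hyC : ∀ᵐ x ∂σ, ‖y x‖ ≤ C) {c : ℕ → 𝕜} (hc : Summable fun n => ‖c n‖ * C ^ n) :
    HasSum (fun n => c n * ∫ x, y x ^ n ∂σ) (∫ x, ∑' n, c n * y x ^ n ∂σ) := by
  have h_bound (n : ℕ) : ∀ᵐ x ∂σ, ‖c n * y x ^ n‖ ≤ ‖c n‖ * C ^ n := by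
    filter_upwards [hyC] with x hx
    rw [norm_mul, norm_pow]
    gcongr
  have h_sum : ∀ᵐ x ∂σ, HasSum (fun n => c n * y x ^ n) (∑' n, c n * y x ^ n) := by
    filter_upwards [ae_all_iff.2 h_bound] with x hx
    exact (Summable.of_norm_bounded hc hx).hasSum
  simpa only [integral_const_mul] using
    hasSum_integral_of_dominated_convergence (fun n _ => ‖c n‖ * C ^ n)
      (fun n => ((hy.pow_const n).const_mul (c n)).aestronglyMeasurable) h_bound
      (Eventually.of_forall fun _ => hc) (integrable_const _) h_sum

theorem hasSum_choose_mul_integral_pow {y : α → ℝ} (hy : Measurable y) {C : ℝ}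
    (hyC : ∀ᵐ x ∂σ, |y x| ≤ C) (r : ℝ) {t : ℝ} (ht : |t| * |C| < 1) :
    HasSum (fun n => Ring.choose r n * (∫ x, y x ^ n ∂σ) * t ^ n)
      (∫ x, (1 + t * y x) ^ r ∂σ) := by
  have h_bound : ∀ᵐ x ∂σ, ‖t * y x‖ ≤ |t| * |C| := by
    filter_upwards [hyC] with x hx
    rw [norm_mul, Real.norm_eq_abs, Real.norm_eq_abs]
    exact mul_le_mul_of_nonneg_left (hx.trans (le_abs_self C)) (abs_nonneg t)
  have h_sum := hasSum_mul_integral_pow (hy.const_mul t) h_bound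
    (summable_norm_choose_mul_pow r (by positivity) ht)
  have h_binomial : ∀ᵐ x ∂σ, ∑' n, Ring.choose r n * (t * y x) ^ n = (1 + t * y x) ^ r := by
    filter_upwards [h_bound] with x hx
    exact (hasSum_choose_mul_pow r (hx.trans_lt ht)).tsum_eq
  rw [integral_congr_ae h_binomial] at h_sum
  simpa only [mul_pow, integral_const_mul, mul_comm (t ^ _), mul_assoc, integral_mul_const]
    using h_sum

/-- The coefficients of the binomial series of a non-integral power do not vanish, so the moments
can be read off the expansion of `t ↦ ∫ (1 + t y) ^ r` at `0`. -/
theorem integral_pow_eq_of_integral_one_add_mul_rpow_eq {y : α → ℝ} (hy : Measurable y) {C : ℝ}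
    (hσ : ∀ᵐ x ∂σ, |y x| ≤ C) (hτ : ∀ᵐ x ∂τ, |y x| ≤ C) {r : ℝ} (hr : ∀ n : ℕ, r ≠ n)
    (h : ∀ᶠ t in 𝓝 (0 : ℝ), ∫ x, (1 + t * y x) ^ r ∂σ = ∫ x, (1 + t * y x) ^ r ∂τ) (n : ℕ) :
    ∫ x, y x ^ n ∂σ = ∫ x, y x ^ n ∂τ := by
  have h_small : ∀ᶠ t in 𝓝 (0 : ℝ), |t| * |C| < 1 := by
    have h_cont : Continuous fun t : ℝ => |t| * |C| := by fun_prop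
    exact h_cont.continuousAt.eventually_lt_const (by simp)
  have h_coeff := eq_of_eventually_hasSum_pow
    (h_small.mono fun t ht => hasSum_choose_mul_integral_pow hy hσ r ht)
    ((h_small.and h).mono fun t ht => ht.2 ▸ hasSum_choose_mul_integral_pow hy hτ r ht.1)
  exact mul_left_cancel₀ (choose_ne_zero_of_ne_natCast hr n) (congrFun h_coeff n)

theorem integral_cexp_eq_of_integral_pow_eq {y : α → ℝ} (hy : Measurable y) {C : ℝ}
    (hσ : ∀ᵐ x ∂σ, |y x| ≤ C) (hτ : ∀ᵐ x ∂τ, |y x| ≤ C)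
    (h : ∀ n : ℕ, ∫ x, y x ^ n ∂σ = ∫ x, y x ^ n ∂τ) :
    ∫ x, Complex.exp (y x * Complex.I) ∂σ = ∫ x, Complex.exp (y x * Complex.I) ∂τ := by
  have h_series (ρ : Measure α) [IsFiniteMeasure ρ] (hρ : ∀ᵐ x ∂ρ, |y x| ≤ C) :
      HasSum (fun n : ℕ => Complex.I ^ n / n.factorial * ((∫ x, y x ^ n ∂ρ : ℝ) : ℂ))
        (∫ x, Complex.exp (y x * Complex.I) ∂ρ) := by
    have h_sum := hasSum_mul_integral_pow (σ := ρ) (y := fun x => (y x : ℂ)) (C := C)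
      (c := fun n : ℕ => Complex.I ^ n / n.factorial) (Complex.measurable_ofReal.comp hy)
      (by simpa only [Complex.norm_real, Real.norm_eq_abs] using hρ)
      (by simpa [div_eq_inv_mul] using Real.summable_pow_div_factorial C)
    have h_exp (x : α) : ∑' n : ℕ, Complex.I ^ n / n.factorial * (y x : ℂ) ^ n =
        Complex.exp (y x * Complex.I) := by
      rw [Complex.exp_eq_exp_ℂ, NormedSpace.exp_eq_tsum_div]
      exact tsum_congr fun n => by rw [mul_pow, div_mul_eq_mul_div, mul_comm]
    simp only [h_exp] at h_sum
    simpa only [← Complex.ofReal_pow, integral_complex_ofReal] using h_sum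
  have hσ_series := h_series σ hσ
  simp only [h] at hσ_series
  exact hσ_series.unique (h_series τ hτ)

theorem measure_eq_of_integral_rpow_eq {ι : Type*} [Fintype ι] {σ τ : Measure (ι → ℝ)}
    [IsFiniteMeasure σ] [IsFiniteMeasure τ] (hσ : ∀ᵐ x ∂σ, x ∈ stdSimplex ℝ ι)
    (hτ : ∀ᵐ x ∂τ, x ∈ stdSimplex ℝ ι) {r : ℝ} (hr : ∀ n : ℕ, r ≠ n)
    (h : ∀ b : ι → ℝ, (∀ j, 0 ≤ b j) →
      ∫ x, (∑ j, b j * x j) ^ r ∂σ = ∫ x, (∑ j, b j * x j) ^ r ∂τ) : σ = τ := by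
  classical
  refine Measure.ext_of_charFunDual (funext fun L => ?_)
  rw [charFunDual_apply, charFunDual_apply]
  obtain ⟨C, hC⟩ :=
    (isCompact_stdSimplex ℝ ι).exists_bound_of_continuousOn L.continuous.continuousOn
  refine integral_cexp_eq_of_integral_pow_eq L.continuous.measurable (hσ.mono hC) (hτ.mono hC) ?_
  refine integral_pow_eq_of_integral_one_add_mul_rpow_eq L.continuous.measurable (hσ.mono hC)
    (hτ.mono hC) hr ?_
  let c (j : ι) : ℝ := L fun i => if j = i then 1 else 0
  have h_affine (t : ℝ) {x : ι → ℝ} (hx : x ∈ stdSimplex ℝ ι) :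
      (1 + t * L x) ^ r = (∑ j, (1 + t * c j) * x j) ^ r := by
    have hLx : L x = ∑ j, x j * c j := LinearMap.pi_apply_eq_sum_univ L.toLinearMap x
    simp only [hLx, add_mul, one_mul, Finset.sum_add_distrib, hx.2, Finset.mul_sum, mul_assoc,
      mul_comm (c _)]
  have h_nonneg : ∀ᶠ t in 𝓝 (0 : ℝ), ∀ j, 0 ≤ 1 + t * c j := by
    refine eventually_all.2 fun j => ?_
    have h_cont : Continuous fun t : ℝ => 1 + t * c j := by fun_prop
    exact (h_cont.continuousAt.eventually_const_lt (by simp)).mono fun t ht => ht.le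
  filter_upwards [h_nonneg] with t ht
  rw [integral_congr_ae (hσ.mono fun x hx => h_affine t hx),
    integral_congr_ae (hτ.mono fun x hx => h_affine t hx)]
  exact h _ ht

end Equimeasurability

section FiniteSupport

variable {α : Type*} [TopologicalSpace α] [MeasurableSpace α] {μ : Measure α}

theorem finite_support_of_card_le [T2Space α] {n : ℕ}
    (h : ∀ (k : ℕ) (U : Fin k → Set α), (∀ i, IsOpen (U i)) → (∀ i, μ (U i) ≠ 0) →
      (Pairwise fun i j => Disjoint (U i) (U j)) → k ≤ n) : μ.support.Finite := by
  by_contra h_inf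
  obtain ⟨T, hT_sub, hT_card⟩ := (Set.not_finite.1 h_inf).exists_subset_card_eq (n + 1)
  obtain ⟨U, hU, hU_disj⟩ := T.finite_toSet.t2_separation
  let x (i : Fin T.card) : α := T.equivFin.symm i
  have hx_mem (i : Fin T.card) : x i ∈ T := (T.equivFin.symm i).2
  have hx_inj : x.Injective := Subtype.val_injective.comp T.equivFin.symm.injective
  have h_mass (i : Fin T.card) : μ (U (x i)) ≠ 0 := by
    have h_pos := (Measure.mem_support_iff_forall _).1 (hT_sub (hx_mem i))
    exact (h_pos _ ((hU _).2.mem_nhds (hU _).1)).ne'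
  have h_card := h T.card (fun i => U (x i)) (fun i => (hU _).2) h_mass fun i j hij =>
    hU_disj (hx_mem i) (hx_mem j) (hx_inj.ne hij)
  omega

theorem measure_singleton_ne_zero_of_mem_support [T1Space α] [HereditarilyLindelofSpace α]
    (hfin : μ.support.Finite) {x : α} (hx : x ∈ μ.support) : μ {x} ≠ 0 := by
  intro h_zero
  have h_nhds : (μ.support \ {x})ᶜ ∈ nhds x :=
    (hfin.subset Set.sdiff_subset).isClosed.isOpen_compl.mem_nhds fun h => h.2 rfl
  refine ((Measure.mem_support_iff_forall _).1 hx _ h_nhds).ne' ?_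
  rw [Set.sdiff_eq, Set.compl_inter, compl_compl]
  exact measure_union_null Measure.measure_compl_support h_zero

theorem exists_enumeration_of_finite_support [T1Space α] [HereditarilyLindelofSpace α]
    (hfin : μ.support.Finite) :
    ∃ (L : ℕ) (x : Fin L → α),
      x.Injective ∧ (∀ k, μ {x k} ≠ 0) ∧ ∀ᵐ y ∂μ, y ∈ Set.range x := by
  have := hfin.to_subtype
  obtain ⟨L, ⟨e⟩⟩ := Finite.exists_equiv_fin μ.support
  refine ⟨L, Subtype.val ∘ e.symm, Subtype.val_injective.comp e.symm.injective,
    fun k => measure_singleton_ne_zero_of_mem_support hfin (e.symm k).2, ?_⟩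
  rw [e.symm.surjective.range_comp, Subtype.range_coe]
  exact Measure.measure_compl_support

end FiniteSupport

section Profile

variable {ι κ Ω Ω' : Type*} [Fintype ι] [MeasurableSpace Ω] [MeasurableSpace Ω'] {p q : ℝ≥0∞}
  [Fact (1 ≤ q)] {μ : Measure Ω} {ν : Measure Ω'}

/-- The sum of the `q`-th powers of the fibre norms of a finite family; for a disjoint positive
family this is the `q`-th power of the fibre norm of its sum. -/
def fibreMass (h : ι → MixedLp p q μ ν) (ω : Ω) : ℝ := ∑ j, ‖h j ω‖ ^ q.toReal

/-- The normalized vector of `q`-th powers of the fibre norms of a finite family: a point of the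
standard simplex, or the junk value `0` where the fibre mass vanishes. -/
def fibreProfile (h : ι → MixedLp p q μ ν) (ω : Ω) : ι → ℝ :=
  fun j => ‖h j ω‖ ^ q.toReal / fibreMass h ω

/-- The weight `‖∑ j, h j ω‖ ^ p` of a fibre, for a disjoint positive family `h`. -/
def fibreWeight (h : ι → MixedLp p q μ ν) (ω : Ω) : ℝ :=
  fibreMass h ω ^ (p.toReal / q.toReal)

/-- The distribution of the fibre profile, weighted by the fibre weight: the measure on the
standard simplex that encodes the norms of all linear combinations of a disjoint positive family. -/
def profileMeasure (h : ι → MixedLp p q μ ν) : Measure (ι → ℝ) :=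
  (μ.withDensity fun ω => ENNReal.ofReal (fibreWeight h ω)).map (fibreProfile h)

section Basic

variable (h : ι → MixedLp p q μ ν)

theorem fibreMass_nonneg (ω : Ω) : 0 ≤ fibreMass h ω :=
  Finset.sum_nonneg fun _ _ => by positivity

theorem fibreProfile_nonneg (ω : Ω) (j : ι) : 0 ≤ fibreProfile h ω j :=
  div_nonneg (by positivity) (fibreMass_nonneg h ω)

theorem fibreWeight_nonneg (ω : Ω) : 0 ≤ fibreWeight h ω :=
  Real.rpow_nonneg (fibreMass_nonneg h ω) _

theorem measurable_fibreMass : Measurable (fibreMass h) :=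
  Finset.measurable_sum _ fun j _ => MixedLp.measurable_norm_rpow (h j)

theorem measurable_fibreProfile : Measurable (fibreProfile h) :=
  measurable_pi_lambda _ fun j => (MixedLp.measurable_norm_rpow (h j)).div (measurable_fibreMass h)

theorem measurable_fibreWeight : Measurable (fibreWeight h) :=
  (measurable_fibreMass h).pow_const _

variable {h}

theorem fibreProfile_mul_fibreMass (ω : Ω) (j : ι) :
    fibreProfile h ω j * fibreMass h ω = ‖h j ω‖ ^ q.toReal := by
  by_cases h_zero : fibreMass h ω = 0
  · rw [h_zero, mul_zero, eq_comm]
    exact (Finset.sum_eq_zero_iff_of_nonneg fun _ _ => by positivity).1 h_zero j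
      (Finset.mem_univ j)
  · exact div_mul_cancel₀ _ h_zero

theorem fibreProfile_mem_stdSimplex {ω : Ω} (hω : fibreMass h ω ≠ 0) :
    fibreProfile h ω ∈ stdSimplex ℝ ι :=
  ⟨fibreProfile_nonneg h ω, by
    simp only [fibreProfile, ← Finset.sum_div]
    exact div_self hω⟩

theorem ae_norm_sum_rpow_eq_fibreMass (hq : q ≠ ∞) (hh : IsDisjointPositive h) :
    ∀ᵐ ω ∂μ, ‖(∑ j, h j) ω‖ ^ q.toReal = fibreMass h ω := by
  filter_upwards [MixedLp.ae_norm_sum_rpow hq hh 1] with ω hω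
  simpa only [fibreMass, Pi.one_apply, one_smul, abs_one, Real.one_rpow, one_mul] using hω

theorem measureReal_profileMeasure {s : Set (ι → ℝ)} (hs : MeasurableSet s) :
    (profileMeasure h).real s = ∫ ω in fibreProfile h ⁻¹' s, fibreWeight h ω ∂μ := by
  have h_meas := measurable_fibreProfile h
  rw [measureReal_def, profileMeasure, Measure.map_apply h_meas hs,
    withDensity_apply _ (h_meas hs),
    integral_eq_lintegral_of_nonneg_ae (Filter.Eventually.of_forall (fibreWeight_nonneg h))
      (measurable_fibreWeight h).aestronglyMeasurable]

end Basic

variable [Fact (1 ≤ p)] {h : ι → MixedLp p q μ ν}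

theorem fibreWeight_ne_zero_iff (hp : p ≠ ∞) (hq : q ≠ ∞) {ω : Ω} :
    fibreWeight h ω ≠ 0 ↔ fibreMass h ω ≠ 0 :=
  (Real.rpow_ne_zero (fibreMass_nonneg h ω)
    (div_pos (toReal_pos_of_one_le hp) (toReal_pos_of_one_le hq)).ne')

theorem integrable_fibreWeight (hp : p ≠ ∞) (hq : q ≠ ∞) (hh : IsDisjointPositive h) :
    Integrable (fibreWeight h) μ := by
  have hp0 : p ≠ 0 := (zero_lt_one.trans_le (Fact.out : 1 ≤ p)).ne'
  refine ((Lp.memLp (∑ j, h j)).integrable_norm_rpow hp0 hp).congr ?_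
  filter_upwards [ae_norm_sum_rpow_eq_fibreMass hq hh] with ω hω
  rw [fibreWeight, ← hω, ← Real.rpow_mul (norm_nonneg _),
    mul_div_cancel₀ _ (toReal_pos_of_one_le hq).ne']

theorem ae_profileMeasure_iff (hp : p ≠ ∞) (hq : q ≠ ∞) {P : (ι → ℝ) → Prop}
    (hP : MeasurableSet {x | P x}) :
    (∀ᵐ x ∂(profileMeasure h), P x) ↔ ∀ᵐ ω ∂μ, fibreMass h ω ≠ 0 → P (fibreProfile h ω) := by
  rw [profileMeasure, ae_map_iff (measurable_fibreProfile h).aemeasurable hP,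
    ae_withDensity_iff (measurable_fibreWeight h).ennreal_ofReal]
  refine Filter.eventually_congr (Filter.Eventually.of_forall fun ω => imp_congr_left ?_)
  rw [← fibreWeight_ne_zero_iff hp hq, ne_eq, ENNReal.ofReal_eq_zero, not_le,
    (fibreWeight_nonneg h ω).lt_iff_ne']

theorem ae_profileMeasure_mem_stdSimplex (hp : p ≠ ∞) (hq : q ≠ ∞) :
    ∀ᵐ x ∂(profileMeasure h), x ∈ stdSimplex ℝ ι :=
  (ae_profileMeasure_iff hp hq (isClosed_stdSimplex ℝ ι).measurableSet).2
    (Filter.Eventually.of_forall fun _ => fibreProfile_mem_stdSimplex)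

theorem isFiniteMeasure_profileMeasure (hp : p ≠ ∞) (hq : q ≠ ∞) (hh : IsDisjointPositive h) :
    IsFiniteMeasure (profileMeasure h) :=
  have := isFiniteMeasure_withDensity_ofReal (integrable_fibreWeight hp hq hh).2
  Measure.isFiniteMeasure_map _ _

theorem integral_profileMeasure (hp : p ≠ ∞) (hq : q ≠ ∞) (hh : IsDisjointPositive h)
    {b : ι → ℝ} (hb : ∀ j, 0 ≤ b j) :
    ∫ x, (∑ j, b j * x j) ^ (p.toReal / q.toReal) ∂(profileMeasure h) =
      ‖∑ j, (b j ^ q.toReal⁻¹) • h j‖ ^ p.toReal := by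
  have h_meas : Measurable fun x : ι → ℝ => ∑ j, b j * x j := by fun_prop
  rw [profileMeasure, integral_map (measurable_fibreProfile h).aemeasurable
      (h_meas.pow_const _).aestronglyMeasurable,
    integral_withDensity_eq_integral_toReal_smul (measurable_fibreWeight h).ennreal_ofReal
      (Filter.Eventually.of_forall fun _ => ENNReal.ofReal_lt_top),
    MixedLp.norm_sum_rpow hp hq hh]
  refine integral_congr_ae (Filter.Eventually.of_forall fun ω => ?_)
  have h_sum : 0 ≤ ∑ j, b j * fibreProfile h ω j :=
    Finset.sum_nonneg fun j _ => mul_nonneg (hb j) (fibreProfile_nonneg h ω j)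
  dsimp only
  rw [ENNReal.toReal_ofReal (fibreWeight_nonneg h ω), smul_eq_mul, fibreWeight,
    ← Real.mul_rpow (fibreMass_nonneg h ω) h_sum, Finset.mul_sum]
  congr 1
  refine Finset.sum_congr rfl fun j _ => ?_
  rw [← fibreProfile_mul_fibreMass, abs_of_nonneg (Real.rpow_nonneg (hb j) _),
    Real.rpow_inv_rpow (hb j) (toReal_pos_of_one_le hq).ne']
  ring

theorem profileMeasure_eq_of_norm_eq {Ω₁ Ω₁' : Type*} [MeasurableSpace Ω₁] [MeasurableSpace Ω₁']
    {μ₁ : Measure Ω₁} {ν₁ : Measure Ω₁'} {h₁ : ι → MixedLp p q μ₁ ν₁} (hp : p ≠ ∞) (hq : q ≠ ∞)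
    (hpq : ∀ n : ℕ, p / q ≠ (n : ℝ≥0∞)) (hh : IsDisjointPositive h)
    (hh₁ : IsDisjointPositive h₁)
    (hnorm : ∀ a : ι → ℝ, ‖∑ j, a j • h j‖ = ‖∑ j, a j • h₁ j‖) :
    profileMeasure h = profileMeasure h₁ := by
  have := isFiniteMeasure_profileMeasure hp hq hh
  have := isFiniteMeasure_profileMeasure hp hq hh₁
  refine measure_eq_of_integral_rpow_eq (ae_profileMeasure_mem_stdSimplex hp hq)
    (ae_profileMeasure_mem_stdSimplex hp hq) (toReal_div_toReal_ne_natCast hp hpq) fun b hb => ?_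
  rw [integral_profileMeasure hp hq hh hb, integral_profileMeasure hp hq hh₁ hb, hnorm]

theorem indicatorLp_sum_ne_zero (hp : p ≠ ∞) (hq : q ≠ ∞) (hh : IsDisjointPositive h)
    {s : Set (ι → ℝ)} (hs : MeasurableSet s) (hmass : profileMeasure h s ≠ 0) :
    indicatorLp (measurable_fibreProfile h hs) (∑ j, h j) ≠ 0 := by
  intro h_zero
  have h_ae : ∀ᵐ x ∂(profileMeasure h), x ∉ s := by
    rw [ae_profileMeasure_iff hp hq hs.compl]
    filter_upwards [Lp.eq_zero_iff_ae_eq_zero.1 h_zero,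
      coeFn_indicatorLp (measurable_fibreProfile h hs) (∑ j, h j),
      ae_norm_sum_rpow_eq_fibreMass hq hh] with ω h_ind_zero h_ind h_sum hω hmem
    rw [h_ind_zero, Set.indicator_of_mem (Set.mem_preimage.2 hmem)] at h_ind
    rw [← h_ind, Pi.zero_apply, norm_zero, Real.zero_rpow (toReal_pos_of_one_le hq).ne'] at h_sum
    exact hω h_sum.symm
  exact hmass (measure_eq_zero_iff_ae_notMem.2 h_ae)

/-- The pieces of `∑ j, h j` over the disjoint sets of profiles `A k` are nonzero disjoint elements
of `S`. -/
theorem card_le_finrank_of_profileMeasure_ne_zero [Fintype κ] (hp : p ≠ ∞) (hq : q ≠ ∞)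
    (hh : IsDisjointPositive h) {S : Submodule ℝ (MixedLp p q μ ν)} [FiniteDimensional ℝ S]
    (hS : ∀ x y : MixedLp p q μ ν, y ∈ S → |x| ≤ |y| → x ∈ S) (hhS : ∀ j, h j ∈ S)
    {A : κ → Set (ι → ℝ)} (hA : ∀ k, MeasurableSet (A k))
    (hdisj : Pairwise fun k l => Disjoint (A k) (A l)) (hmass : ∀ k, profileMeasure h (A k) ≠ 0) :
    Fintype.card κ ≤ Module.finrank ℝ S := by
  have h_sum : IsDisjointPositive fun _ : Unit => ∑ j, h j :=
    ⟨fun _ => Finset.sum_nonneg fun j _ => hh.1 j, fun i j hij => (hij rfl).elim⟩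
  have h_pieces := h_sum.indicator (fun k => measurable_fibreProfile h (hA k)) fun k l hkl =>
    (hdisj hkl).preimage (fibreProfile h)
  exact (h_pieces.comp_injective (Prod.mk_left_injective ())).card_le_finrank
    (fun k => indicatorLp_sum_ne_zero hp hq hh (hA k) (hmass k))
    fun k => hS _ _ (Submodule.sum_mem _ fun j _ => hhS j)
      (abs_indicatorLp_le (measurable_fibreProfile h (hA k)) _)

theorem finite_support_profileMeasure (hp : p ≠ ∞) (hq : q ≠ ∞) (hh : IsDisjointPositive h)
    {S : Submodule ℝ (MixedLp p q μ ν)} [FiniteDimensional ℝ S]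
    (hS : ∀ x y : MixedLp p q μ ν, y ∈ S → |x| ≤ |y| → x ∈ S) (hhS : ∀ j, h j ∈ S) :
    (profileMeasure h).support.Finite :=
  finite_support_of_card_le fun k _ hU hmass hdisj => (Fintype.card_fin k).ge.trans <|
    card_le_finrank_of_profileMeasure_ne_zero hp hq hh hS hhS (fun i => (hU i).measurableSet)
      hdisj hmass

end Profile

theorem rpow_sum_of_card_le_one {ι : Type*} {s : Finset ι} (hs : s.card ≤ 1) (b : ι → ℝ) {r : ℝ}
    (hr : r ≠ 0) : (∑ i ∈ s, b i) ^ r = ∑ i ∈ s, b i ^ r := by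
  rcases s.eq_empty_or_nonempty with rfl | hne
  · rw [Finset.sum_empty, Finset.sum_empty, Real.zero_rpow hr]
  · obtain ⟨i, rfl⟩ := Finset.card_eq_one.1 (hs.antisymm hne.card_pos)
    rw [Finset.sum_singleton, Finset.sum_singleton]

section RowBlocks

variable {ι κ X Y : Type*} [Fintype κ] [DecidableEq κ] {p q : ℝ≥0∞}
  [NormedAddCommGroup X] [NormedSpace ℝ X] [NormedAddCommGroup Y] [NormedSpace ℝ Y]
  {I : Finset (κ × ι)}

/-- The linear combinations of a family indexed by pairs have the norm of an `ℓ_p`-sum of `ℓ_q`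
spaces, the first index numbering the summands: `HasRowBlocks` in an arbitrary normed space. -/
def HasRowBlockNorm (p q : ℝ≥0∞) (I : Finset (κ × ι)) (φ : I → X) : Prop :=
  ∀ a : I → ℝ, ‖∑ i : I, a i • φ i‖ ^ p.toReal =
    ∑ k : κ, (∑ i : I with i.1.1 = k, |a i| ^ q.toReal) ^ (p.toReal / q.toReal)

/-- A family `x` is split into disjoint positive elements `φ (k, j)` with the norm of an
`ℓ_p`-sum of `ℓ_q` spaces, column `j` of the splitting adding up to `x j`. -/
structure IsRowBlockDecomposition [DecidableEq ι] [Lattice X] (p q : ℝ≥0∞) (c : I → ℝ) (φ : I → X)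
    (x : ι → X) : Prop where
  isDisjointPositive : IsDisjointPositive φ
  hasRowBlockNorm : HasRowBlockNorm p q I φ
  eq_sum : ∀ j, x j = ∑ i : I with i.1.2 = j, c i • φ i

variable [Fact (1 ≤ p)]

theorem HasRowBlockNorm.norm_sum_eq (hp : p ≠ ∞) {φ : I → X} {ψ : I → Y}
    (hφ : HasRowBlockNorm p q I φ) (hψ : HasRowBlockNorm p q I ψ) (a : I → ℝ) :
    ‖∑ i, a i • φ i‖ = ‖∑ i, a i • ψ i‖ :=
  (Real.rpow_left_inj (norm_nonneg _) (norm_nonneg _) (toReal_pos_of_one_le hp).ne').1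
    ((hφ a).trans (hψ a).symm)

theorem HasRowBlockNorm.norm_sum_column [DecidableEq ι] [Fact (1 ≤ q)] (hp : p ≠ ∞) (hq : q ≠ ∞)
    {φ : I → X} (hφ : HasRowBlockNorm p q I φ) (j : ι) (a : I → ℝ) :
    ‖∑ i : I with i.1.2 = j, a i • φ i‖ ^ p.toReal = ∑ i : I with i.1.2 = j, |a i| ^ p.toReal := by
  have hp0 := (toReal_pos_of_one_le hp).ne'
  have hq0 := (toReal_pos_of_one_le hq).ne'
  have h_card (k : κ) : ({i : I | i.1.2 = j ∧ i.1.1 = k} : Finset I).card ≤ 1 := by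
    simp only [Finset.card_le_one, Finset.mem_filter, Finset.mem_univ, true_and]
    rintro i ⟨rfl, rfl⟩ i' ⟨h_snd, h_fst⟩
    exact Subtype.ext (Prod.ext h_fst.symm h_snd.symm)
  have h_row (k : κ) :
      (∑ i : I with i.1.1 = k, |if i.1.2 = j then a i else 0| ^ q.toReal) ^
        (p.toReal / q.toReal) =
      ∑ i : I with i.1.2 = j ∧ i.1.1 = k, |a i| ^ p.toReal := by
    have h_ite (i : I) : |if i.1.2 = j then a i else 0| ^ q.toReal =
        if i.1.2 = j then |a i| ^ q.toReal else 0 := by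
      split_ifs
      · rfl
      · rw [abs_zero, Real.zero_rpow hq0]
    simp only [h_ite]
    rw [← Finset.sum_filter, Finset.filter_comm, Finset.filter_filter,
      rpow_sum_of_card_le_one (h_card k) _ (div_ne_zero hp0 hq0)]
    refine Finset.sum_congr rfl fun i _ => ?_
    rw [← Real.rpow_mul (abs_nonneg _), mul_div_cancel₀ _ hq0]
  have h_norm := hφ fun i => if i.1.2 = j then a i else 0
  simp only [h_row, ite_smul, zero_smul, ← Finset.sum_filter, ← Finset.filter_filter] at h_norm
  rw [h_norm, Finset.sum_fiberwise]

theorem HasRowBlockNorm.norm_eq_one [Fact (1 ≤ q)] (hp : p ≠ ∞) (hq : q ≠ ∞) {φ : I → X}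
    (hφ : HasRowBlockNorm p q I φ) (i : I) : ‖φ i‖ = 1 := by
  classical
  have hp0 := (toReal_pos_of_one_le hp).ne'
  have h_norm := hφ.norm_sum_column hp hq i.1.2 (Pi.single i 1)
  have h_mem : i ∈ ({i' : I | i'.1.2 = i.1.2} : Finset I) := by simp
  rw [Finset.sum_eq_single_of_mem i h_mem fun i' _ hne => by
      rw [Pi.single_eq_of_ne hne, zero_smul],
    Finset.sum_eq_single_of_mem i h_mem fun i' _ hne => by
      rw [Pi.single_eq_of_ne hne, abs_zero, Real.zero_rpow hp0],
    Pi.single_eq_same, one_smul, abs_one, Real.one_rpow] at h_norm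
  exact (Real.rpow_left_inj (norm_nonneg _) zero_le_one hp0).1
    (h_norm.trans (Real.one_rpow _).symm)

end RowBlocks

section AtomWeight

variable {ι : Type*} {p q : ℝ≥0∞}

/-- The norm of the piece of the `j`-th member of a family on which the fibre profile is `y`,
computed from the profile measure `σ` of the family. -/
def atomWeight (p q : ℝ≥0∞) (σ : Measure (ι → ℝ)) (y : ι → ℝ) (j : ι) : ℝ :=
  y j ^ q.toReal⁻¹ * σ.real {y} ^ p.toReal⁻¹

theorem atomWeight_rpow [Fact (1 ≤ q)] (hq : q ≠ ∞) {σ : Measure (ι → ℝ)} {y : ι → ℝ} {j : ι}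
    (hy : 0 ≤ y j) :
    atomWeight p q σ y j ^ q.toReal = y j * σ.real {y} ^ (q.toReal / p.toReal) := by
  rw [atomWeight, Real.mul_rpow (by positivity) (by positivity),
    Real.rpow_inv_rpow hy (toReal_pos_of_one_le hq).ne', ← Real.rpow_mul measureReal_nonneg,
    inv_mul_eq_div]

end AtomWeight

section Decomposition

variable {ι κ Ω Ω' : Type*} [Fintype ι] [MeasurableSpace Ω] [MeasurableSpace Ω'] {p q : ℝ≥0∞}
  [Fact (1 ≤ q)] {μ : Measure Ω} {ν : Measure Ω'} {h : ι → MixedLp p q μ ν}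

/-- The component of `h j` on the set where the fibre profile of the family `h` is `y`. -/
def profilePiece (h : ι → MixedLp p q μ ν) (y : ι → ℝ) (j : ι) : MixedLp p q μ ν :=
  indicatorLp (measurable_fibreProfile h (measurableSet_singleton y)) (h j)

theorem IsDisjointPositive.profilePiece [Countable κ] (hh : IsDisjointPositive h)
    {x : κ → ι → ℝ} (hx : x.Injective) :
    IsDisjointPositive fun i : κ × ι => profilePiece h (x i.1) i.2 :=
  hh.indicator (fun k => measurable_fibreProfile h (measurableSet_singleton (x k)))
    fun _ _ hkl => (Set.disjoint_singleton.2 (hx.ne hkl)).preimage (fibreProfile h)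

theorem ae_profilePiece (y : ι → ℝ) (j : ι) :
    ∀ᵐ ω ∂μ, profilePiece h y j ω = if fibreProfile h ω = y then h j ω else 0 := by
  filter_upwards [coeFn_indicatorLp
    (measurable_fibreProfile h (measurableSet_singleton y)) (h j)] with ω hω
  rw [profilePiece, hω]
  split_ifs with h_eq
  · exact Set.indicator_of_mem (show ω ∈ fibreProfile h ⁻¹' {y} from h_eq) _
  · exact Set.indicator_of_notMem (show ω ∉ fibreProfile h ⁻¹' {y} from h_eq) _

theorem ae_norm_profilePiece_rpow (hq : q ≠ ∞) (y : ι → ℝ) (j : ι) :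
    ∀ᵐ ω ∂μ, ‖profilePiece h y j ω‖ ^ q.toReal =
      if fibreProfile h ω = y then y j * fibreMass h ω else 0 := by
  filter_upwards [ae_profilePiece (h := h) y j] with ω hω
  rw [hω]
  split_ifs with h_eq
  · rw [← h_eq, fibreProfile_mul_fibreMass]
  · rw [norm_zero, Real.zero_rpow (toReal_pos_of_one_le hq).ne']

theorem profilePiece_eq_zero (hq : q ≠ ∞) {y : ι → ℝ} {j : ι} (hy : y j = 0) :
    profilePiece h y j = 0 := by
  rw [Lp.eq_zero_iff_ae_eq_zero]
  filter_upwards [ae_norm_profilePiece_rpow (h := h) hq y j] with ω hω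
  rw [hy, zero_mul, ite_self] at hω
  exact norm_eq_zero.1
    ((Real.rpow_eq_zero (norm_nonneg _) (toReal_pos_of_one_le hq).ne').1 hω)

variable [Fact (1 ≤ p)] [Fintype κ] {x : κ → ι → ℝ}

theorem sum_profilePiece (hp : p ≠ ∞) (hq : q ≠ ∞) (hx : x.Injective)
    (hae : ∀ᵐ y ∂(profileMeasure h), y ∈ Set.range x) (j : ι) :
    ∑ k, profilePiece h (x k) j = h j := by
  classical
  have hae := (ae_profileMeasure_iff hp hq (Set.finite_range x).measurableSet).1 hae
  refine Lp.ext ?_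
  filter_upwards [hae, ae_all_iff.2 fun k => ae_profilePiece (h := h) (x k) j,
    Lp.coeFn_finsetSum Finset.univ fun k => profilePiece h (x k) j] with ω h_range h_piece h_sum
  rw [h_sum, Finset.sum_apply]
  simp only [h_piece]
  by_cases h_zero : h j ω = 0
  · simp only [h_zero, ite_self, Finset.sum_const_zero]
  · have h_mass : fibreMass h ω ≠ 0 := by
      intro h_mass
      have h_norm := fibreProfile_mul_fibreMass (h := h) ω j
      rw [h_mass, mul_zero] at h_norm
      exact (Real.rpow_pos_of_pos (norm_pos_iff.2 h_zero) _).ne h_norm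
    obtain ⟨k, hk⟩ := h_range h_mass
    rw [Fintype.sum_eq_single k fun l hl => if_neg fun h_eq => hl (hx (h_eq.symm.trans hk.symm)),
      if_pos hk.symm]

variable [DecidableEq κ] {I : Finset (κ × ι)}

theorem ae_rpow_sum_profilePiece (hp : p ≠ ∞) (hq : q ≠ ∞) (hx : x.Injective) (a : I → ℝ) :
    ∀ᵐ ω ∂μ, (∑ i : I, |a i| ^ q.toReal * ‖profilePiece h (x i.1.1) i.1.2 ω‖ ^ q.toReal) ^
        (p.toReal / q.toReal) =
      ∑ k, (∑ i : I with i.1.1 = k, |a i| ^ q.toReal * x k i.1.2) ^ (p.toReal / q.toReal) *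
        (fibreProfile h ⁻¹' {x k}).indicator (fibreWeight h) ω := by
  classical
  have hr := (div_pos (toReal_pos_of_one_le hp) (toReal_pos_of_one_le hq)).ne'
  filter_upwards [ae_all_iff.2 fun i : I =>
    ae_norm_profilePiece_rpow (h := h) hq (x i.1.1) i.1.2] with ω h_piece
  have h_card : ({k | fibreProfile h ω = x k} : Finset κ).card ≤ 1 := by
    simp only [Finset.card_le_one, Finset.mem_filter, Finset.mem_univ, true_and]
    exact fun k hk l hl => hx (hk.symm.trans hl)
  have h_sum : ∑ i : I, |a i| ^ q.toReal * ‖profilePiece h (x i.1.1) i.1.2 ω‖ ^ q.toReal =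
      ∑ k with fibreProfile h ω = x k,
        (∑ i : I with i.1.1 = k, |a i| ^ q.toReal * x k i.1.2) * fibreMass h ω := by
    rw [← Finset.sum_fiberwise _ fun i : I => i.1.1, Finset.sum_filter]
    refine Finset.sum_congr rfl fun k _ => ?_
    have h_row : ∀ i ∈ ({i : I | i.1.1 = k} : Finset I),
        |a i| ^ q.toReal * ‖profilePiece h (x i.1.1) i.1.2 ω‖ ^ q.toReal =
          if fibreProfile h ω = x k then |a i| ^ q.toReal * x k i.1.2 * fibreMass h ω else 0 := by
      intro i hi
      rw [h_piece, (Finset.mem_filter.1 hi).2, mul_ite, mul_zero, mul_assoc]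
    rw [Finset.sum_congr rfl h_row, Finset.sum_ite_irrel, Finset.sum_const_zero, Finset.sum_mul]
  rw [h_sum, rpow_sum_of_card_le_one h_card _ hr, Finset.sum_filter]
  refine Finset.sum_congr rfl fun k _ => ?_
  split_ifs with h_eq
  · have h_nonneg : 0 ≤ ∑ i : I with i.1.1 = k, |a i| ^ q.toReal * x k i.1.2 :=
      Finset.sum_nonneg fun i _ =>
        mul_nonneg (by positivity) (h_eq ▸ fibreProfile_nonneg h ω i.1.2)
    rw [Set.indicator_of_mem (show ω ∈ fibreProfile h ⁻¹' {x k} from h_eq), fibreWeight,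
      Real.mul_rpow h_nonneg (fibreMass_nonneg h ω)]
  · rw [Set.indicator_of_notMem (show ω ∉ fibreProfile h ⁻¹' {x k} from h_eq), mul_zero]

theorem norm_sum_profilePiece_rpow (hp : p ≠ ∞) (hq : q ≠ ∞) (hh : IsDisjointPositive h)
    (hx : x.Injective) (a : I → ℝ) :
    ‖∑ i : I, a i • profilePiece h (x i.1.1) i.1.2‖ ^ p.toReal =
      ∑ k, (∑ i : I with i.1.1 = k, |a i| ^ q.toReal * x k i.1.2) ^ (p.toReal / q.toReal) *
        (profileMeasure h).real {x k} := by
  have h_meas (k : κ) : MeasurableSet (fibreProfile h ⁻¹' {x k}) :=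
    measurable_fibreProfile h (measurableSet_singleton _)
  refine (MixedLp.norm_sum_rpow hp hq
    ((hh.profilePiece hx).comp_injective Subtype.val_injective) a).trans ?_
  refine (integral_congr_ae (ae_rpow_sum_profilePiece hp hq hx a)).trans ?_
  rw [integral_finsetSum _ fun k _ =>
    ((integrable_fibreWeight hp hq hh).indicator (h_meas k)).const_mul _]
  refine Finset.sum_congr rfl fun k _ => ?_
  rw [integral_const_mul, integral_indicator (h_meas k),
    measureReal_profileMeasure (measurableSet_singleton _)]

theorem hasRowBlockNorm_profilePiece (hp : p ≠ ∞) (hq : q ≠ ∞) (hh : IsDisjointPositive h)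
    (hx : x.Injective) (hmass : ∀ k, 0 < (profileMeasure h).real {x k})
    (hpos : ∀ i ∈ I, 0 < x i.1 i.2) :
    HasRowBlockNorm p q I fun i =>
      (atomWeight p q (profileMeasure h) (x i.1.1) i.1.2)⁻¹ • profilePiece h (x i.1.1) i.1.2 := by
  intro a
  have hr : q.toReal / p.toReal * (p.toReal / q.toReal) = 1 := by
    have := (toReal_pos_of_one_le hp).ne'
    have := (toReal_pos_of_one_le hq).ne'
    field_simp
  simp only [smul_smul]
  rw [norm_sum_profilePiece_rpow hp hq hh hx]
  refine Finset.sum_congr rfl fun k _ => ?_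
  set t := (profileMeasure h).real {x k} with ht
  have ht_pos : 0 < t := hmass k
  have h_row : ∀ i ∈ ({i : I | i.1.1 = k} : Finset I),
      |a i * (atomWeight p q (profileMeasure h) (x i.1.1) i.1.2)⁻¹| ^ q.toReal * x k i.1.2 =
        |a i| ^ q.toReal * (t ^ (q.toReal / p.toReal))⁻¹ := by
    rintro ⟨⟨k', j⟩, hi⟩ h_mem
    obtain rfl : k' = k := (Finset.mem_filter.1 h_mem).2
    have hx_pos : 0 < x k' j := hpos _ hi
    have hw : 0 ≤ atomWeight p q (profileMeasure h) (x k') j := by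
      unfold atomWeight
      positivity
    rw [abs_mul, Real.mul_rpow (abs_nonneg _) (abs_nonneg _), abs_inv, abs_of_nonneg hw,
      Real.inv_rpow hw, atomWeight_rpow hq hx_pos.le, mul_inv, mul_assoc, mul_right_comm,
      inv_mul_cancel₀ hx_pos.ne', one_mul]
  have h_nonneg : 0 ≤ ∑ i : I with i.1.1 = k, |a i| ^ q.toReal :=
    Finset.sum_nonneg fun i _ => by positivity
  rw [Finset.sum_congr rfl h_row, ← Finset.sum_mul, Real.mul_rpow h_nonneg (by positivity),
    Real.inv_rpow (by positivity), ← Real.rpow_mul ht_pos.le, hr, Real.rpow_one, mul_assoc,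
    inv_mul_cancel₀ ht_pos.ne', mul_one]

theorem exists_isRowBlockDecomposition [DecidableEq ι] (hp : p ≠ ∞) (hq : q ≠ ∞)
    (hh : IsDisjointPositive h) (hx : x.Injective) (hmass : ∀ k, profileMeasure h {x k} ≠ 0)
    (hae : ∀ᵐ y ∂(profileMeasure h), y ∈ Set.range x) (hI : ∀ i, i ∈ I ↔ x i.1 i.2 ≠ 0) :
    ∃ φ : I → MixedLp p q μ ν, IsRowBlockDecomposition p q
      (fun i => atomWeight p q (profileMeasure h) (x i.1.1) i.1.2) φ h := by
  have := isFiniteMeasure_profileMeasure hp hq hh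
  have h_mass (k : κ) : 0 < (profileMeasure h).real {x k} :=
    ENNReal.toReal_pos (hmass k) (measure_ne_top _ _)
  have h_simplex (k : κ) : x k ∈ stdSimplex ℝ ι := by
    by_contra h_notMem
    refine hmass k (measure_mono_null ?_ (ae_iff.1 (ae_profileMeasure_mem_stdSimplex hp hq)))
    exact Set.singleton_subset_iff.2 h_notMem
  have h_pos : ∀ i ∈ I, 0 < x i.1 i.2 := fun i hi =>
    ((h_simplex i.1).1 i.2).lt_of_ne' ((hI i).1 hi)
  have h_weight (i : I) : 0 < atomWeight p q (profileMeasure h) (x i.1.1) i.1.2 :=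
    mul_pos (Real.rpow_pos_of_pos (h_pos _ i.2) _) (Real.rpow_pos_of_pos (h_mass _) _)
  refine ⟨_, ((hh.profilePiece hx).comp_injective Subtype.val_injective).smul fun i =>
    (inv_pos.2 (h_weight i)).le, hasRowBlockNorm_profilePiece hp hq hh hx h_mass h_pos,
    fun j => ?_⟩
  simp only [smul_inv_smul₀ (h_weight _).ne', Finset.sum_filter, Function.comp_apply]
  rw [Finset.sum_coe_sort I fun i => if i.2 = j then profilePiece h (x i.1) i.2 else 0,
    Finset.sum_subset (Finset.subset_univ I) fun i _ hi => by
      rw [profilePiece_eq_zero hq (not_not.1 (mt (hI i).2 hi)), ite_self],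
    Fintype.sum_prod_type]
  simp only [Finset.sum_ite_eq', Finset.mem_univ, if_true]
  exact (sum_profilePiece hp hq hx hae j).symm

end Decomposition

section UnitVectors

variable {α ι E : Type*} [MeasurableSpace α] [MeasurableSingletonClass α] {p : ℝ≥0∞}
  [NormedAddCommGroup E] [NormedSpace ℝ E]

/-- The inclusion of `E` as the `i`-th summand of the `ℓ_p`-sum `ℓ_p(α; E)` of copies of `E`,
the latter being encoded as an `L_p` space for the counting measure. -/
def singleLp (p : ℝ≥0∞) (i : α) : E →ₗ[ℝ] Lp E p (Measure.count : Measure α) where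
  toFun v := indicatorConstLp p (measurableSet_singleton i)
    ((Measure.count_singleton i).trans_ne ENNReal.one_ne_top) v
  map_add' _ _ := indicatorConstLp_add.symm
  map_smul' t v := by
    refine Lp.ext ?_
    filter_upwards [indicatorConstLp_coeFn (p := p) (hs := measurableSet_singleton i)
        (hμs := (Measure.count_singleton i).trans_ne ENNReal.one_ne_top) (c := t • v),
      indicatorConstLp_coeFn (p := p) (hs := measurableSet_singleton i)
        (hμs := (Measure.count_singleton i).trans_ne ENNReal.one_ne_top) (c := v),
      Lp.coeFn_smul t (indicatorConstLp p (measurableSet_singleton i)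
        ((Measure.count_singleton i).trans_ne ENNReal.one_ne_top) v)] with x h_tv h_v h_smul
    rw [h_tv, RingHom.id_apply, h_smul, Pi.smul_apply, h_v]
    exact Set.indicator_const_smul_apply {i} t (fun _ => v) x

theorem coeFn_singleLp (i : α) (v : E) : ⇑(singleLp p i v) = ({i} : Set α).indicator fun _ => v :=
  funext <| Measure.ae_count_iff.1 <| indicatorConstLp_coeFn (p := p)
    (hs := measurableSet_singleton i)
    (hμs := (Measure.count_singleton i).trans_ne ENNReal.one_ne_top)

theorem norm_singleLp [hp1 : Fact (1 ≤ p)] (hp : p ≠ ∞) (i : α) (v : E) :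
    ‖singleLp p i v‖ = ‖v‖ := by
  have h_norm := norm_indicatorConstLp (hs := measurableSet_singleton i) (c := v)
    (hμs := (Measure.count_singleton i).trans_ne ENNReal.one_ne_top)
    (zero_lt_one.trans_le hp1.out).ne' hp
  have h_count : (Measure.count : Measure α).real {i} = 1 := by
    rw [measureReal_def, Measure.count_singleton, ENNReal.toReal_one]
  exact h_norm.trans (by rw [h_count, Real.one_rpow, mul_one])

theorem sum_singleLp [Fintype α] (f : Lp E p (Measure.count : Measure α)) :
    ∑ i, singleLp p i (f i) = f := by
  classical
  refine Lp.ext ?_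
  filter_upwards [Lp.coeFn_finsetSum Finset.univ fun i => singleLp p i (f i)] with k h_sum
  rw [h_sum, Finset.sum_apply]
  simp only [coeFn_singleLp, Set.indicator_apply, Set.mem_singleton_iff, Finset.sum_ite_eq,
    Finset.mem_univ, if_true]

theorem IsDisjointPositive.singleLp [Countable α] [Countable ι] [Lattice E] [HasSolidNorm E]
    [IsOrderedAddMonoid E] {v : ι → E} (hv : IsDisjointPositive v) :
    IsDisjointPositive fun i : α × ι => singleLp p i.1 (v i.2) := by
  rw [isDisjointPositive_iff_ae]
  refine Filter.Eventually.of_forall fun k => ?_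
  simp only [coeFn_singleLp]
  exact hv.indicator_const (A := fun i : α => {i})
    (fun _ _ hij => Set.disjoint_singleton.2 hij) k

end UnitVectors

section MatrixUnits

variable {κ ι : Type*} [MeasurableSpace κ] [MeasurableSingletonClass κ] [MeasurableSpace ι]
  [MeasurableSingletonClass ι] {p q : ℝ≥0∞} [Fact (1 ≤ q)]

/-- The matrix units of the `ℓ_p`-sum of copies of `ℓ_q`, the first index numbering the summands. -/
def matrixUnit (p q : ℝ≥0∞) [Fact (1 ≤ q)] (i : κ × ι) :
    MixedLp p q (Measure.count : Measure κ) (Measure.count : Measure ι) :=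
  singleLp p i.1 (singleLp q i.2 1)

theorem isDisjointPositive_matrixUnit [Countable κ] [Countable ι] :
    IsDisjointPositive fun i : κ × ι => matrixUnit p q i := by
  have h_one : IsDisjointPositive fun _ : Unit => (1 : ℝ) :=
    ⟨fun _ => zero_le_one, fun _ _ h => (h rfl).elim⟩
  have h_row_unit : IsDisjointPositive fun j : ι × Unit => singleLp q j.1 (1 : ℝ) :=
    h_one.singleLp
  have h_row : IsDisjointPositive fun j : ι => singleLp q j (1 : ℝ) :=
    h_row_unit.comp_injective (f := fun j => (j, ())) (Prod.mk_left_injective ())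
  have h_unit : IsDisjointPositive fun i : κ × ι => singleLp p i.1 (singleLp q i.2 (1 : ℝ)) :=
    h_row.singleLp
  exact h_unit

theorem matrixUnit_ne_zero [Fact (1 ≤ p)] (hp : p ≠ ∞) (hq : q ≠ ∞) (i : κ × ι) :
    matrixUnit p q i ≠ 0 := by
  rw [← norm_ne_zero_iff, matrixUnit, norm_singleLp hp, norm_singleLp hq, norm_one]
  exact one_ne_zero

theorem sum_smul_matrixUnit [Fintype κ] [Fintype ι]
    (f : MixedLp p q (Measure.count : Measure κ) (Measure.count : Measure ι)) :
    ∑ i : κ × ι, f i.1 i.2 • matrixUnit p q i = f := by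
  conv_rhs => rw [← sum_singleLp f]
  rw [Fintype.sum_prod_type]
  refine Finset.sum_congr rfl fun k _ => ?_
  conv_rhs => rw [← sum_singleLp (f k), map_sum]
  refine Finset.sum_congr rfl fun j _ => ?_
  rw [matrixUnit, ← map_smul, ← map_smul, smul_eq_mul, mul_one]

theorem hasRowBlockNorm_matrixUnit [Fintype κ] [Countable ι] [Fact (1 ≤ p)] [DecidableEq κ]
    (hp : p ≠ ∞) (hq : q ≠ ∞) (I : Finset (κ × ι)) :
    HasRowBlockNorm p q I fun i => matrixUnit p q i.1 := by
  intro a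
  refine (MixedLp.norm_sum_rpow hp hq
    (isDisjointPositive_matrixUnit.comp_injective Subtype.val_injective) a).trans ?_
  rw [integral_count]
  refine Finset.sum_congr rfl fun k _ => ?_
  rw [Finset.sum_filter]
  congr 1
  refine Finset.sum_congr rfl fun i _ => ?_
  rw [Function.comp_apply, matrixUnit, coeFn_singleLp, Set.indicator_apply]
  simp only [Set.mem_singleton_iff, eq_comm (a := k)]
  split_ifs
  · rw [norm_singleLp hq, norm_one, Real.one_rpow, mul_one]
  · rw [norm_zero, Real.zero_rpow (toReal_pos_of_one_le hq).ne', mul_zero]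

variable [Finite κ] [Finite ι]

/-- The matrix units as a basis of the space `ℓ_p(κ; ℓ_q(ι))`. -/
def matrixUnitBasis [Fact (1 ≤ p)] (hp : p ≠ ∞) (hq : q ≠ ∞) :
    Module.Basis (κ × ι) ℝ
      (MixedLp p q (Measure.count : Measure κ) (Measure.count : Measure ι)) :=
  Module.Basis.mk (isDisjointPositive_matrixUnit.linearIndependent (matrixUnit_ne_zero hp hq))
    fun f _ => by
      have := Fintype.ofFinite κ
      have := Fintype.ofFinite ι
      rw [← sum_smul_matrixUnit f]
      exact Submodule.sum_mem _ fun i _ => Submodule.smul_mem _ _ (Submodule.subset_span ⟨i, rfl⟩)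

theorem isBand_span_image_matrixUnit [Fact (1 ≤ p)] (hp : p ≠ ∞) (hq : q ≠ ∞)
    (s : Set (κ × ι)) : IsBand (Submodule.span ℝ (matrixUnit p q '' s)) := by
  have h_basis : ⇑(matrixUnitBasis hp hq) = (matrixUnit p q : κ × ι → _) :=
    Module.Basis.coe_mk _ _
  have hb : IsDisjointPositive (matrixUnitBasis (κ := κ) (ι := ι) hp hq) :=
    h_basis ▸ isDisjointPositive_matrixUnit
  exact h_basis ▸ hb.isBand_span_image s

end MatrixUnits

theorem HasRowBlockNorm.isBK_generate {κ ι : Type} {X : Type*} [Fintype κ] [DecidableEq κ]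
    [Finite ι] {p q : ℝ≥0∞} [Fact (1 ≤ p)] [Fact (1 ≤ q)] [NormedAddCommGroup X] [NormedSpace ℝ X]
    [Lattice X] [IsOrderedAddMonoid X] [PosSMulMono ℝ X] {I : Finset (κ × ι)} {φ : I → X}
    (hp : p ≠ ∞) (hq : q ≠ ∞) (hφ : IsDisjointPositive φ) (hne : ∀ i, φ i ≠ 0)
    (hrow : HasRowBlockNorm p q I φ) :
    IsBK p q (ClosedSublattice.generate (Set.range φ)).toSubmodule := by
  let _ : MeasurableSpace κ := ⊤
  let _ : MeasurableSpace ι := ⊤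
  obtain ⟨g, hg, h_gen⟩ := hφ.exists_latticeEmbedding_generate hne
    (isDisjointPositive_matrixUnit.comp_injective Subtype.val_injective)
    ((hasRowBlockNorm_matrixUnit hp hq I).norm_sum_eq hp hrow)
  refine ⟨hφ.finiteDimensional_generate, κ, ι, ⊤, ⊤, Measure.count, Measure.count, g, hg, ?_⟩
  have h_range : LinearMap.range g.toLinearMap =
      Submodule.span ℝ (matrixUnit p q '' (I : Set (κ × ι))) := by
    rw [LinearMap.range_eq_map, ← hφ.span_range_generator, Submodule.map_span, ← Set.range_comp,
      Set.image_eq_range]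
    exact congrArg (fun s => Submodule.span ℝ (Set.range s)) (funext h_gen)
  exact h_range ▸ isBand_span_image_matrixUnit hp hq _

section Refinements

variable {κ ι X : Type*} [DecidableEq ι] [NormedAddCommGroup X] [NormedSpace ℝ X] [Lattice X]
  {p q : ℝ≥0∞} [Fact (1 ≤ p)] [Fact (1 ≤ q)] {I : Finset (κ × ι)} {c : I → ℝ} {φ : I → X}
  {x : ι → X}

/-- `IsAtomRefinement` in an arbitrary normed lattice, for arbitrary index sets of rows and
columns. -/
def IsColumnRefinement (p q : ℝ≥0∞) [Fact (1 ≤ p)] [Fact (1 ≤ q)] (x : ι → X)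
    (I : Finset (κ × ι)) (φ : I → X) : Prop :=
  IsDisjointNormalizedPositive φ ∧
  (∀ j, x j ∈ (ClosedSublattice.generate (φ '' {i : I | i.1.2 = j})).toSubmodule) ∧
  (∀ (j : ι) (a : I → ℝ),
    ‖∑ i : I with i.1.2 = j, a i • φ i‖ ^ p.toReal = ∑ i : I with i.1.2 = j, |a i| ^ p.toReal) ∧
  IsBK p q (ClosedSublattice.generate (Set.range φ)).toSubmodule

theorem IsColumnRefinement.generate_le (h : IsColumnRefinement p q x I φ) :
    (ClosedSublattice.generate (Set.range x)).toSubmodule ≤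
      (ClosedSublattice.generate (Set.range φ)).toSubmodule := by
  refine ClosedSublattice.generate_le (Set.range_subset_iff.2 fun j => ?_)
  exact ClosedSublattice.generate_le
    ((Set.image_subset_range _ _).trans (ClosedSublattice.subset_generate _)) (h.2.1 j)

variable [Fintype κ] [DecidableEq κ]

theorem IsRowBlockDecomposition.ne_zero (h : IsRowBlockDecomposition p q c φ x) (hp : p ≠ ∞)
    (hq : q ≠ ∞) (i : I) : φ i ≠ 0 :=
  norm_ne_zero_iff.1 ((h.hasRowBlockNorm.norm_eq_one hp hq i).trans_ne one_ne_zero)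

end Refinements

theorem IsColumnRefinement.isK {κ ι X : Type} [DecidableEq ι] [NormedAddCommGroup X]
    [NormedSpace ℝ X] [Lattice X] {p q : ℝ≥0∞} [Fact (1 ≤ p)] [Fact (1 ≤ q)] {I : Finset (κ × ι)}
    {φ : I → X} {x : ι → X} (h : IsColumnRefinement p q x I φ) :
    IsK p q (ClosedSublattice.generate (Set.range x)).toSubmodule :=
  let ⟨j, hj, _⟩ := ClosedSublattice.exists_latticeEmbedding_of_le h.generate_le
  ⟨_, _, _, _, h.2.2.2, j, hj⟩

section Extensions

variable {κ ι : Type} {X Y : Type*} [Fintype κ] [DecidableEq κ] [Finite ι] [DecidableEq ι]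
  [NormedAddCommGroup X] [NormedSpace ℝ X] [Lattice X] [IsOrderedAddMonoid X] [PosSMulMono ℝ X]
  [NormedAddCommGroup Y] [NormedSpace ℝ Y] [Lattice Y] [IsOrderedAddMonoid Y] [PosSMulMono ℝ Y]
  {p q : ℝ≥0∞} [Fact (1 ≤ p)] [Fact (1 ≤ q)] {I : Finset (κ × ι)} {c : I → ℝ} {φ : I → X}
  {ψ : I → Y} {x : ι → X}

namespace IsRowBlockDecomposition

theorem isColumnRefinement (h : IsRowBlockDecomposition p q c φ x) (hp : p ≠ ∞) (hq : q ≠ ∞) :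
    IsColumnRefinement p q x I φ := by
  refine ⟨⟨h.isDisjointPositive.1, h.hasRowBlockNorm.norm_eq_one hp hq, h.isDisjointPositive.2⟩,
    fun j => ?_, h.hasRowBlockNorm.norm_sum_column hp hq,
    h.hasRowBlockNorm.isBK_generate hp hq h.isDisjointPositive (h.ne_zero hp hq)⟩
  rw [h.eq_sum]
  exact Submodule.sum_mem _ fun i hi => Submodule.smul_mem _ _
    (ClosedSublattice.subset_generate _ ⟨i, (Finset.mem_filter.1 hi).2, rfl⟩)

theorem exists_extension (hx : IsDisjointPositive x) (h : IsRowBlockDecomposition p q c φ x)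
    (hp : p ≠ ∞) (hq : q ≠ ∞)
    {j : (ClosedSublattice.generate (Set.range x)).toSubmodule →ₗᵢ[ℝ]
      (ClosedSublattice.generate (Set.range φ)).toSubmodule} (hj : ∀ y, (j y : X) = y)
    {f : (ClosedSublattice.generate (Set.range x)).toSubmodule →ₗᵢ[ℝ] Y}
    (hf : IsRowBlockDecomposition p q c ψ (f ∘ ClosedSublattice.generator x)) :
    ∃ g : (ClosedSublattice.generate (Set.range φ)).toSubmodule →ₗᵢ[ℝ] Y,
      IsLatticeEmbedding g ∧ ∀ y, g (j y) = f y := by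
  obtain ⟨g, hg, hg_gen⟩ := h.isDisjointPositive.exists_latticeEmbedding_generate
    (h.ne_zero hp hq) hf.isDisjointPositive (hf.hasRowBlockNorm.norm_sum_eq hp h.hasRowBlockNorm)
  have hj_gen (l : ι) : j (ClosedSublattice.generator x l) =
      ∑ i : I with i.1.2 = l, c i • ClosedSublattice.generator φ i := by
    refine Subtype.ext ((hj _).trans ((h.eq_sum l).trans ?_))
    rw [Submodule.coe_sum]
    rfl
  have h_gen (l : ι) :
      g (j (ClosedSublattice.generator x l)) = f (ClosedSublattice.generator x l) := by
    rw [hj_gen, map_sum]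
    simp only [map_smul, hg_gen]
    exact (hf.eq_sum l).symm
  exact ⟨g, hg, DFunLike.congr_fun (LinearMap.ext_on_range
    (f := g.toLinearMap ∘ₗ j.toLinearMap) (g := f.toLinearMap) hx.span_range_generator h_gen)⟩

end IsRowBlockDecomposition

end Extensions

section Embeddings

variable {ι Ω Ω' Ω₁ Ω₁' : Type*} [Fintype ι] [MeasurableSpace Ω] [MeasurableSpace Ω']
  [MeasurableSpace Ω₁] [MeasurableSpace Ω₁'] {μ : Measure Ω} {ν : Measure Ω'} {μ₁ : Measure Ω₁}
  {ν₁ : Measure Ω₁'} {p q : ℝ≥0∞} [Fact (1 ≤ p)] [Fact (1 ≤ q)] {e : ι → MixedLp p q μ ν}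

theorem profileMeasure_comp_generator (hp : p ≠ ∞) (hq : q ≠ ∞)
    (hpq : ∀ n : ℕ, p / q ≠ (n : ℝ≥0∞)) (he : IsDisjointPositive e)
    {f : (ClosedSublattice.generate (Set.range e)).toSubmodule →ₗᵢ[ℝ] MixedLp p q μ₁ ν₁}
    (hf : IsLatticeEmbedding f) :
    profileMeasure (f ∘ ClosedSublattice.generator e) = profileMeasure e := by
  refine profileMeasure_eq_of_norm_eq hp hq hpq (he.generator.map hf) he fun a => ?_
  simp only [Function.comp_apply, ← map_smul, ← map_sum, f.norm_map, Submodule.coe_norm,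
    Submodule.coe_sum]
  rfl

theorem finite_support_profileMeasure_of_isK (hp : p ≠ ∞) (hq : q ≠ ∞)
    (hpq : ∀ n : ℕ, p / q ≠ (n : ℝ≥0∞)) (he : IsDisjointPositive e)
    (hK : IsK p q (ClosedSublattice.generate (Set.range e)).toSubmodule) :
    (profileMeasure e).support.Finite := by
  obtain ⟨F, _, _, _, ⟨_, _, _, _, _, _, _, g, hg, hband⟩, f, hf⟩ := hK
  rw [← profileMeasure_comp_generator hp hq hpq he (hg.comp hf)]
  exact finite_support_profileMeasure hp hq (he.generator.map (hg.comp hf)) hband.1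
    fun j => ⟨f (ClosedSublattice.generator e j), rfl⟩

end Embeddings

section Main

variable {ι Ω Ω' : Type} [Finite ι] [MeasurableSpace Ω] [MeasurableSpace Ω']
  {μ : Measure Ω} {ν : Measure Ω'} {p q : ℝ≥0∞} [Fact (1 ≤ p)] [Fact (1 ≤ q)]
  {e : ι → MixedLp p q μ ν}

theorem exists_uniform_isRowBlockDecomposition [DecidableEq ι] (hp : p ≠ ∞)
    (hq : q ≠ ∞) (hpq : ∀ n : ℕ, p / q ≠ (n : ℝ≥0∞)) (he : IsDisjointPositive e)
    (hK : IsK p q (ClosedSublattice.generate (Set.range e)).toSubmodule) :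
    ∃ (L : ℕ) (I : Finset (Fin L × ι)) (c : I → ℝ), ∀ (Ω₁ Ω₁' : Type) [MeasurableSpace Ω₁]
      [MeasurableSpace Ω₁'] (μ₁ : Measure Ω₁) (ν₁ : Measure Ω₁')
      (f : (ClosedSublattice.generate (Set.range e)).toSubmodule →ₗᵢ[ℝ] MixedLp p q μ₁ ν₁),
      IsLatticeEmbedding f →
        ∃ φ, IsRowBlockDecomposition p q c φ (f ∘ ClosedSublattice.generator e) := by
  have := Fintype.ofFinite ι
  obtain ⟨L, x, hx, hmass, hae⟩ :=
    exists_enumeration_of_finite_support (finite_support_profileMeasure_of_isK hp hq hpq he hK)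
  refine ⟨L, Finset.univ.filter fun i => x i.1 i.2 ≠ 0,
    fun i => atomWeight p q (profileMeasure e) (x i.1.1) i.1.2, fun Ω₁ Ω₁' _ _ μ₁ ν₁ f hf => ?_⟩
  -- An embedding does not change the profile measure, so its atoms serve every embedding.
  rw [← profileMeasure_comp_generator hp hq hpq he hf] at hmass hae ⊢
  exact exists_isRowBlockDecomposition hp hq (he.generator.map hf) hx hmass hae
    fun i => Finset.mem_filter_univ i

theorem exists_uniform_extension (hp : p ≠ ∞) (hq : q ≠ ∞) (hpq : ∀ n : ℕ, p / q ≠ (n : ℝ≥0∞))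
    (he : IsDisjointPositive e)
    (hK : IsK p q (ClosedSublattice.generate (Set.range e)).toSubmodule) :
    ∃ (E' : Type) (_ : NormedAddCommGroup E') (_ : NormedSpace ℝ E') (_ : Lattice E')
      (j : (ClosedSublattice.generate (Set.range e)).toSubmodule →ₗᵢ[ℝ] E'),
      IsBK p q E' ∧ IsLatticeEmbedding j ∧ ∀ (Ω₁ Ω₁' : Type) [MeasurableSpace Ω₁]
        [MeasurableSpace Ω₁'] (μ₁ : Measure Ω₁) (ν₁ : Measure Ω₁')
        (f : (ClosedSublattice.generate (Set.range e)).toSubmodule →ₗᵢ[ℝ] MixedLp p q μ₁ ν₁),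
        IsLatticeEmbedding f →
          ∃ g : E' →ₗᵢ[ℝ] MixedLp p q μ₁ ν₁, IsLatticeEmbedding g ∧ ∀ y, g (j y) = f y := by
  classical
  obtain ⟨L, I, c, h_decomp⟩ := exists_uniform_isRowBlockDecomposition hp hq hpq he hK
  obtain ⟨φ, hφ⟩ := h_decomp _ _ _ _ _ (ClosedSublattice.isLatticeEmbedding_subtypeₗᵢ _)
  replace hφ : IsRowBlockDecomposition p q c φ e := hφ
  have h_ref := hφ.isColumnRefinement hp hq
  obtain ⟨j, hj, hj_coe⟩ := ClosedSublattice.exists_latticeEmbedding_of_le h_ref.generate_le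
  refine ⟨_, _, _, _, j, h_ref.2.2.2, hj, fun Ω₁ Ω₁' _ _ μ₁ ν₁ f hf => ?_⟩
  obtain ⟨ψ, hψ⟩ := h_decomp _ _ _ _ f hf
  exact hφ.exists_extension he hp hq hj_coe hψ

theorem exists_isColumnRefinement [DecidableEq ι] (hp : p ≠ ∞) (hq : q ≠ ∞)
    (hpq : ∀ n : ℕ, p / q ≠ (n : ℝ≥0∞)) (he : IsDisjointPositive e)
    (hK : IsK p q (ClosedSublattice.generate (Set.range e)).toSubmodule) :
    ∃ (L : ℕ) (I : Finset (Fin L × ι)) (φ : I → MixedLp p q μ ν),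
      IsColumnRefinement p q e I φ ∧ HasRowBlockNorm p q I φ := by
  obtain ⟨L, I, c, h_decomp⟩ := exists_uniform_isRowBlockDecomposition hp hq hpq he hK
  obtain ⟨φ, hφ⟩ := h_decomp _ _ _ _ _ (ClosedSublattice.isLatticeEmbedding_subtypeₗᵢ _)
  replace hφ : IsRowBlockDecomposition p q c φ e := hφ
  exact ⟨L, I, φ, hφ.isColumnRefinement hp hq, hφ.hasRowBlockNorm⟩

theorem theoremt_general [DecidableEq ι] {Ω₁ Ω₁' Ω₂ Ω₂' : Type} [MeasurableSpace Ω₁]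
    [MeasurableSpace Ω₁'] [MeasurableSpace Ω₂] [MeasurableSpace Ω₂'] {μ₁ : Measure Ω₁}
    {ν₁ : Measure Ω₁'} {μ₂ : Measure Ω₂} {ν₂ : Measure Ω₂'} (hp : p ≠ ∞) (hq : q ≠ ∞)
    (hpq : ∀ n : ℕ, p / q ≠ (n : ℝ≥0∞)) (he : IsDisjointPositive e) :
    (IsK p q (ClosedSublattice.generate (Set.range e)).toSubmodule ↔
      ∃ (L : ℕ) (I : Finset (Fin L × ι)) (φ : I → MixedLp p q μ ν),
        IsColumnRefinement p q e I φ) ∧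
    (IsK p q (ClosedSublattice.generate (Set.range e)).toSubmodule →
      ∃ (L : ℕ) (I : Finset (Fin L × ι)) (φ : I → MixedLp p q μ ν),
        IsColumnRefinement p q e I φ ∧ HasRowBlockNorm p q I φ) ∧
    (IsK p q (ClosedSublattice.generate (Set.range e)).toSubmodule →
      ∀ (f₁ : (ClosedSublattice.generate (Set.range e)).toSubmodule →ₗᵢ[ℝ] MixedLp p q μ₁ ν₁)
        (f₂ : (ClosedSublattice.generate (Set.range e)).toSubmodule →ₗᵢ[ℝ] MixedLp p q μ₂ ν₂),
        IsLatticeEmbedding f₁ → IsLatticeEmbedding f₂ →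
        ∃ (E' : Type) (_ : NormedAddCommGroup E') (_ : NormedSpace ℝ E') (_ : Lattice E')
          (j : (ClosedSublattice.generate (Set.range e)).toSubmodule →ₗᵢ[ℝ] E')
          (g₁ : E' →ₗᵢ[ℝ] MixedLp p q μ₁ ν₁) (g₂ : E' →ₗᵢ[ℝ] MixedLp p q μ₂ ν₂),
          IsBK p q E' ∧ IsLatticeEmbedding j ∧ IsLatticeEmbedding g₁ ∧ IsLatticeEmbedding g₂ ∧
          (∀ y, g₁ (j y) = f₁ y) ∧ (∀ y, g₂ (j y) = f₂ y)) := by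
  refine ⟨⟨fun hK => ?_, fun ⟨_, _, _, h⟩ => h.isK⟩, exists_isColumnRefinement hp hq hpq he,
    fun hK f₁ f₂ hf₁ hf₂ => ?_⟩
  · obtain ⟨L, I, φ, h, -⟩ := exists_isColumnRefinement hp hq hpq he hK
    exact ⟨L, I, φ, h⟩
  · obtain ⟨E', _, _, _, j, hE', hj, h_extend⟩ := exists_uniform_extension hp hq hpq he hK
    obtain ⟨g₁, hg₁, h_eq₁⟩ := h_extend _ _ _ _ f₁ hf₁
    obtain ⟨g₂, hg₂, h_eq₂⟩ := h_extend _ _ _ _ f₂ hf₂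
    exact ⟨E', _, _, _, j, g₁, g₂, hE', hj, hg₁, hg₂, h_eq₁, h_eq₂⟩

end Main

end

theorem theoremt (p q : ℝ≥0∞) [Fact (1 ≤ p)] [Fact (1 ≤ q)] (hp : p ≠ ∞) (hq : q ≠ ∞)
    (hpq : ∀ n : ℕ, p / q ≠ (n : ℝ≥0∞)) (m : ℕ) (e : Fin m → LpLq p q)
    (he : IsDisjointNormalizedPositive e) :
    (IsK p q (ClosedSublattice.generate (Set.range e)).toSubmodule ↔
      ∃ (L : ℕ) (I : Finset (Fin L × Fin m)) (φ : I → LpLq p q), IsAtomRefinement p q e I φ) ∧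
    (IsK p q (ClosedSublattice.generate (Set.range e)).toSubmodule →
      ∃ (L : ℕ) (I : Finset (Fin L × Fin m)) (φ : I → LpLq p q),
        IsAtomRefinement p q e I φ ∧ HasRowBlocks p q I φ) ∧
    (IsK p q (ClosedSublattice.generate (Set.range e)).toSubmodule →
      ∀ f₁ f₂ : (ClosedSublattice.generate (Set.range e)).toSubmodule →ₗᵢ[ℝ] LpLq p q,
        IsLatticeEmbedding f₁ → IsLatticeEmbedding f₂ →
        ∃ (E' : Type) (_ : NormedAddCommGroup E') (_ : NormedSpace ℝ E') (_ : Lattice E')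
          (ι : (ClosedSublattice.generate (Set.range e)).toSubmodule →ₗᵢ[ℝ] E')
          (g₁ g₂ : E' →ₗᵢ[ℝ] LpLq p q),
          IsBK p q E' ∧ IsLatticeEmbedding ι ∧ IsLatticeEmbedding g₁ ∧ IsLatticeEmbedding g₂ ∧
          (∀ x, g₁ (ι x) = f₁ x) ∧ (∀ x, g₂ (ι x) = f₂ x)) :=
  theoremt_general hp hq hpq ⟨he.1, he.2.2⟩
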